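/- \textbf{Setting.} A network consists of a finite directed multigraph $(V,E)$ with a source $s$ and a sink $t\neq s$, transit times $\tau_e\ge 0$ such that no directed cycle has total transit time $0$, capacities $\nu_e>0$, and a constant inflow rate $u_0>0$ at $s$. For a labelling $\ell^\circ\in\mathbb R^V$, an arc $e=vw$ is \emph{active} if $\ell^\circ_w\ge \ell^\circ_v+\tau_e$ and \emph{resetting} if $\ell^\circ_w> \ell^\circ_v+\tau_e$. Let $\Omega$ be the set of \emph{feasible} labellings: every node is reachable from $s$ along active arcs, and every resetting arc lies on an $s$-$t$-path of active arcs. \textbf{Flows over time.} A flow over time continuing from $\ell^\circ$ consists of non-negative locally integrable rates $f_e^+,f_e^-:\mathbb R\to\mathbb R$ for every arc $e=vw$, with $f^+_e(\xi)=0$ for $\xi<\ell^\circ_v$ and $f_e^-(\xi)=0$ for $\xi<\ell^\circ_v+\tau_e$. The queue on $e$ at time $\xi\ge \ell^\circ_v$ is \[ z_e(\xi)=\nu_e\max\{0,\ell^\circ_w-\ell^\circ_v-\tau_e\}+\int_{\ell^\circ_v}^{\xi}\bigl(f_e^+(\zeta)-f_e^-(\zeta+\tau_e)\bigr)\,d\zeta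 , \] and for almost all $\xi\ge\ell^\circ_v$ it is required that $f^-_e(\xi+\tau_e)=\nu_e$ if $z_e(\xi)>0$ and $f^-_e(\xi+\tau_e)=\min\{f_e^+(\xi),\nu_e\}$ otherwise. Moreover, for every node $v$ and almost all $\xi\ge\ell^\circ_v$, the net outflow $\sum_{e\in\delta^+(v)}f_e^+(\xi)-\sum_{e\in\delta^-(v)}f_e^-(\xi)$ equals $0$ if $v\ne s,t$, equals $u_0$ if $v=s$, and is at most $0$ if $v=t$. The exit time of $e$ for entrance time $\xi$ is $T_e(\xi)=\xi+z_e(\xi)/\nu_e+\tau_e$. \textbf{Nash flows over time.} The earliest arrival time functions $\ell_v:[0,\infty)\to\mathbb R$ satisfy, for all $\theta\ge0$, $\ell_s(\theta)=\ell^\circ_s+\theta$ and $\ell_w(\theta)=\min_{e=vw\in\delta^-(w)}T_e(\ell_v(\theta))$ for $w\neq s$. The flow is a Nash flow over time if for every arc $e=vw$ and almost every $\xi$ with $f_e^+(\xi)>0$ there is $\theta\ge0$ with $\ell_v(\theta)=\xi$ and $\ell_w(\theta)=T_e(\xi)$, that is, flow enters only arcs on currently shortest paths. \textbf{Theorem.}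 For every network and every feasible initial labelling $\ell^\circ\in\Omega$, the earliest arrival time functions $(\ell_v)_{v\in V}$ of any Nash flow over time with $\ell(0)=\ell^\circ$ are uniquely determined: if $(\ell_v)_{v\in V}$ and $(\tilde\ell_v)_{v\in V}$ are the earliest arrival time functions of two Nash flows over time continuing from $\ell^\circ$ with $\ell(0)=\tilde\ell(0)=\ell^\circ$, then $\ell_v(\theta)=\tilde\ell_v(\theta)$ for all $v\in V$ and all $\theta\ge0$. -/

import Mathlib

open MeasureTheory

/-- A single-source single-sink network for the deterministic (fluid) queueing model: a directed
multigraph with vertices `V` and arcs `E`, a source `s`, a sink `t`, transit times `τ`,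
capacities `ν`, and a constant network inflow rate `u₀` at the source.
No directed cycle has total transit time zero. -/
structure Network (V E : Type*) where
  src : E → V
  tgt : E → V
  s : V
  t : V
  τ : E → ℝ
  ν : E → ℝ
  u₀ : ℝ
  s_ne_t : s ≠ t
  τ_nonneg : ∀ e, 0 ≤ τ e
  ν_pos : ∀ e, 0 < ν e
  u₀_pos : 0 < u₀
  -- `c 0, …, c n` is a closed walk: addition in `Fin (n + 1)` is cyclic
  cycle_pos : ∀ (n : ℕ) (c : Fin (n + 1) → E),
    (∀ i, tgt (c i) = src (c (i + 1))) → 0 < ∑ i, τ (c i)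

/-- The inflow rates `f⁺` and the outflow rates `f⁻` of the arcs, as functions of time. -/
structure FlowRates (E : Type*) where
  inflow : E → ℝ → ℝ
  outflow : E → ℝ → ℝ

namespace Network

variable {V E : Type*}

/-- The arc `e = vw` is active for the labelling `l`: `l w ≥ l v + τ e`. -/
def IsActive (N : Network V E) (l : V → ℝ) (e : E) : Prop :=
  l (N.src e) + N.τ e ≤ l (N.tgt e)

/-- The arc `e = vw` is resetting for the labelling `l`: `l w > l v + τ e`,
that is, it has a positive queue. -/
def IsResetting (N : Network V E) (l : V → ℝ) (e : E) : Prop :=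
  l (N.src e) + N.τ e < l (N.tgt e)

/-- There is a directed path of active arcs from `v` to `w`. -/
def ActiveReach (N : Network V E) (l : V → ℝ) (v w : V) : Prop :=
  Relation.ReflTransGen (fun a b => ∃ e, N.src e = a ∧ N.tgt e = b ∧ N.IsActive l e) v w

/-- The set `Ω` of feasible labellings: every node can be reached from the source along active
arcs, and every resetting arc lies on an active path from the source to the sink (its tail is
reachable from `s` by the first condition). -/
def feasibleLabellings (N : Network V E) : Set (V → ℝ) :=
  {l | (∀ v, N.ActiveReach l N.s v) ∧
    ∀ e, N.IsResetting l e → N.ActiveReach l (N.tgt e) N.t}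

/-- The amount of flow in the queue of `e = vw` at time `ξ ≥ l₀ v`. At time `l₀ v` the waiting time
in the queue is `max 0 (l₀ w - l₀ v - τ e)`; afterwards the queue grows by the inflow
and shrinks by the flow that leaves it (and leaves the arc `τ e` time units later). -/
noncomputable def queue (N : Network V E) (l₀ : V → ℝ) (f : FlowRates E) (e : E) (ξ : ℝ) : ℝ :=
  N.ν e * max 0 (l₀ (N.tgt e) - l₀ (N.src e) - N.τ e) +
    ∫ ζ in (l₀ (N.src e))..ξ, (f.inflow e ζ - f.outflow e (ζ + N.τ e))

/-- The time at which a particle that enters `e` at time `ξ` leaves `e`: waiting time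
`queue / ν` plus transit time `τ`. -/
noncomputable def exitTime (N : Network V E) (l₀ : V → ℝ) (f : FlowRates E) (e : E) (ξ : ℝ) : ℝ :=
  ξ + N.queue l₀ f e ξ / N.ν e + N.τ e

/-- `f` is a feasible flow over time that continues from the initial labelling `l₀`. Particles
entering the network from time `l₀ s` on are considered; the particles that entered earlier pass
every node `v` before time `l₀ v`, so the evolution is described at `v` from time `l₀ v` on. -/
structure IsFlowOverTime [Fintype E] [DecidableEq V] (N : Network V E) (l₀ : V → ℝ)
    (f : FlowRates E) : Prop where
  inflow_nonneg : ∀ e ξ, 0 ≤ f.inflow e ξ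
  outflow_nonneg : ∀ e ξ, 0 ≤ f.outflow e ξ
  inflow_integrable : ∀ e, LocallyIntegrable (f.inflow e) volume
  outflow_integrable : ∀ e, LocallyIntegrable (f.outflow e) volume
  inflow_start : ∀ e ξ, ξ < l₀ (N.src e) → f.inflow e ξ = 0
  outflow_start : ∀ e ξ, ξ < l₀ (N.src e) + N.τ e → f.outflow e ξ = 0
  -- queues operate at capacity
  outflow_eq : ∀ e, ∀ᵐ ξ ∂(volume : Measure ℝ), l₀ (N.src e) ≤ ξ →
    f.outflow e (ξ + N.τ e) =
      if 0 < N.queue l₀ f e ξ then N.ν e else min (f.inflow e ξ) (N.ν e)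
  -- flow conservation at the inner nodes, at the source and at the sink
  conservation : ∀ v, v ≠ N.s → v ≠ N.t → ∀ᵐ ξ ∂(volume : Measure ℝ), l₀ v ≤ ξ →
    ∑ e with N.src e = v, f.inflow e ξ = ∑ e with N.tgt e = v, f.outflow e ξ
  source : ∀ᵐ ξ ∂(volume : Measure ℝ), l₀ N.s ≤ ξ →
    ∑ e with N.src e = N.s, f.inflow e ξ = N.u₀ + ∑ e with N.tgt e = N.s, f.outflow e ξ
  sink : ∀ᵐ ξ ∂(volume : Measure ℝ), l₀ N.t ≤ ξ →
    ∑ e with N.src e = N.t, f.inflow e ξ ≤ ∑ e with N.tgt e = N.t, f.outflow e ξ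

/-- `l v θ` is the earliest time at which the particle `θ ≥ 0`, which enters the network at the
source at time `l₀ s + θ`, can arrive at `v`. -/
structure IsEarliestArrival (N : Network V E) (l₀ : V → ℝ) (f : FlowRates E)
    (l : V → ℝ → ℝ) : Prop where
  source : ∀ θ, 0 ≤ θ → l N.s θ = l₀ N.s + θ
  bellman : ∀ w, w ≠ N.s → ∀ θ, 0 ≤ θ →
    IsLeast {a : ℝ | ∃ e, N.tgt e = w ∧ a = N.exitTime l₀ f e (l (N.src e) θ)} (l w θ)

/-- `f` is a Nash flow over time (dynamic equilibrium) continuing from `l₀`, with earliest arrival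
time functions `l`: almost all flow entering an arc `e = vw` at time `ξ` consists of particles `θ`
that arrive at `v` as early as possible and for which `e` lies on a currently shortest path. -/
structure IsNashFlow [Fintype E] [DecidableEq V] (N : Network V E) (l₀ : V → ℝ)
    (f : FlowRates E) (l : V → ℝ → ℝ) : Prop where
  flow : N.IsFlowOverTime l₀ f
  arrival : N.IsEarliestArrival l₀ f l
  equilibrium : ∀ e, ∀ᵐ ξ ∂(volume : Measure ℝ), 0 < f.inflow e ξ →
    ∃ θ, 0 ≤ θ ∧ l (N.src e) θ = ξ ∧ l (N.tgt e) θ = N.exitTime l₀ f e ξ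

end Network

/-! Parametrize by particles `θ`: with `X e θ` the inflow into `e = vw` up to time `l v θ`, FIFO
queues and the equilibrium condition turn a Nash flow into a static flow `X` of value `u₀ * θ`
(`IsNashFlow.isTrajectory`). At almost every `θ` there are slopes `l'`, `x'`
(`IsTrajectory.ae_exists_isSlope`): `x'` is a flow of value `u₀` with `x' e ≤ ν e * l' w`, with
equality on queues; it vanishes on inactive arcs, and `l' w = l' v` if `l w = l v + τ e`.

It suffices that every trajectory leaves a feasible labelling `l₀`, attained at `a`, as `l₀ + lam *
(θ - a)`, where `(lam, x)` is any thin flow with resetting for `l₀` (`IsTrajectory.eq_linear`).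
Resetting and inactive arcs keep their status for a while by continuity. The difficulty lies with
arcs having `l₀ w = l₀ v + τ e`, whose status may oscillate immediately after the start.

This is resolved by a potential `Γ` of the form `∑ ν e * Φ e - u₀ * (p t - p s)`, where `p v = (l v
- l₀ v) / lam v` and `Φ e` is `arcPotential`. Arcwise `x e * (p w - p v) ≤ ν e * Φ e`, and summing
against the flow `x` gives `Γ ≥ 0`. With `r v = l' v / lam v`, the inequality `a - b ≤ a * (log a -
log b)` gives, up to a regularization of the logarithm, `ν e * Φ' e ≤ x' e * (log (r w) - log (r
v))`. Summing against the flow `x'`, with `r s = 1`, yields `Γ' ≤ u₀ * log (r t) - u₀ * (r t - 1) ≤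
0`. Since `Γ` starts at `0`, it stays `0`, and every arcwise inequality is tight. Tightness says
that `x` saturates each queue that has formed and vanishes on each arc that has become inactive
(`IsTrajectory.thinFlow_compat`).

Hence `(lam, x)` and `(l', x')` obey the same rules for the current queues. Comparing the two flows
over a cut gives `lam ≤ l'` and a partial converse along queues (`IsSlope.compare`). Induction along
the active arcs then gives equality of the labels.

Thin flows exist by smoothing, a maximal subsolution, and compactness (`exists_isThinFlow`).
Feasibility survives along the linear piece and under limits from the left, so local uniqueness
propagates to all `θ ≥ 0` (`IsTrajectory.unique`). -/

namespace Network

variable {V E : Type*}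

/-! ### Active arcs: acyclicity, ranks, reachability -/

theorem exists_walk_of_transGen_active (N : Network V E) (l : V → ℝ) {a b : V}
    (h : Relation.TransGen (fun a b => ∃ e, N.src e = a ∧ N.tgt e = b ∧ N.IsActive l e) a b) :
    ∃ (n : ℕ) (c : ℕ → E), N.src (c 0) = a ∧ N.tgt (c n) = b ∧
      (∀ i < n, N.tgt (c i) = N.src (c (i + 1))) ∧ ∀ i ≤ n, N.IsActive l (c i) := by
  induction h with
  | single h =>
    obtain ⟨e, h1, h2, h3⟩ := h
    exact ⟨0, fun _ => e, h1, h2, by simp, fun _ _ => h3⟩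
  | tail _ h ih =>
    obtain ⟨n, c, h1, h2, h3, h4⟩ := ih
    obtain ⟨e, g1, g2, g3⟩ := h
    refine ⟨n + 1, fun i => if i ≤ n then c i else e, by simpa using h1, by simpa using g2, ?_, ?_⟩
    · intro i hi
      have hi' : i ≤ n := by omega
      rcases Nat.lt_or_ge i n with hin | hin
      · have : i + 1 ≤ n := hin
        simp only [hi', if_true, this]
        exact h3 i hin
      · have : i = n := by omega
        subst this
        simp [h2, g1]
    · intro i _
      by_cases hin : i ≤ n
      · simpa [hin] using h4 i hin
      · simpa [hin] using g3

/-- Active arcs form an acyclic graph, whatever the labelling. -/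
theorem not_transGen_active_self (N : Network V E) (l : V → ℝ) (a : V) :
    ¬ Relation.TransGen (fun a b => ∃ e, N.src e = a ∧ N.tgt e = b ∧ N.IsActive l e) a a := by
  intro h
  obtain ⟨n, c, h1, h2, h3, h4⟩ := N.exists_walk_of_transGen_active l h
  have hc : ∀ i : Fin (n + 1), N.tgt (c i) = N.src (c ((i + 1 : Fin (n + 1)) : ℕ)) := by
    intro i
    rcases Nat.lt_or_ge (i : ℕ) n with hi | hi
    · rw [Fin.val_add_one_of_lt (Fin.lt_def.2 (by simpa using hi))]
      exact h3 i hi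
    · have hi' : i = Fin.last n := Fin.ext (by have := i.2; simp; omega)
      subst hi'
      simp [h1, h2]
  have hpos := N.cycle_pos n (fun i => c i) hc
  -- Activity bounds each transit time by a label difference; around the cycle these cancel, as the
  -- cyclic shift is a bijection.
  have hle : ∑ i : Fin (n + 1), N.τ (c i) ≤
      ∑ i : Fin (n + 1), (l (N.src (c ((i + 1 : Fin (n + 1)) : ℕ))) - l (N.src (c i))) := by
    refine Finset.sum_le_sum fun i _ => ?_
    have := h4 i (Nat.lt_succ_iff.1 i.2)
    rw [IsActive, hc i] at this
    linarith
  have heq := Equiv.sum_comp (Equiv.addRight (1 : Fin (n + 1)))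
    (fun i : Fin (n + 1) => l (N.src (c i)))
  simp only [Equiv.coe_addRight] at heq
  rw [Finset.sum_sub_distrib, heq, sub_self] at hle
  linarith

/-- The active arcs admit a topological numbering. -/
theorem exists_rank [Fintype V] (N : Network V E) (l : V → ℝ) :
    ∃ r : V → ℕ, (∀ v, r v ≤ Fintype.card V) ∧
      ∀ e, N.IsActive l e → r (N.src e) < r (N.tgt e) := by
  classical
  let R : V → V → Prop :=
    Relation.TransGen (fun a b => ∃ e, N.src e = a ∧ N.tgt e = b ∧ N.IsActive l e)
  -- The rank counts the nodes with a nonempty active path to `w`. Along an active arc this set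
  -- grows strictly: by acyclicity the tail is a new member.
  refine ⟨fun w => (Finset.univ.filter fun v => R v w).card, fun v => Finset.card_le_univ _,
    fun e he => Finset.card_lt_card ?_⟩
  have hR : R (N.src e) (N.tgt e) := Relation.TransGen.single ⟨e, rfl, rfl, he⟩
  rw [Finset.ssubset_iff_of_subset]
  · exact ⟨N.src e, by simpa using hR, by simpa using N.not_transGen_active_self l _⟩
  · intro v hv
    simp only [Finset.mem_filter, Finset.mem_univ, true_and] at hv ⊢
    exact hv.trans hR

theorem ActiveReach.le {N : Network V E} {l : V → ℝ} {v w : V} (h : N.ActiveReach l v w) :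
    l v ≤ l w := by
  induction h with
  | refl => exact le_rfl
  | tail _ h ih =>
    obtain ⟨e, rfl, rfl, h⟩ := h
    exact ih.trans (by have := N.τ_nonneg e; unfold IsActive at h; linarith)

/-- If every node but the source has an active entering arc, then every node can be reached from
the source. -/
theorem activeReach_source [Fintype V] (N : Network V E) {l : V → ℝ}
    (h : ∀ w, w ≠ N.s → ∃ e, N.tgt e = w ∧ N.IsActive l e) (v : V) : N.ActiveReach l N.s v := by
  obtain ⟨r, -, hr⟩ := N.exists_rank l
  induction hn : r v using Nat.strong_induction_on generalizing v with
  | _ n ih =>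
    by_cases hv : v = N.s
    · subst hv; exact Relation.ReflTransGen.refl
    · obtain ⟨e, rfl, he⟩ := h v hv
      exact (ih _ (hn ▸ hr e he) _ rfl).tail ⟨e, rfl, rfl, he⟩

/-- A set of nodes that contains a node reachable from outside is entered by an active arc. -/
theorem exists_enter_of_activeReach {N : Network V E} {l : V → ℝ} {v w : V}
    (h : N.ActiveReach l v w) (U : Set V) (hv : v ∉ U) (hw : w ∈ U) :
    ∃ e, N.IsActive l e ∧ N.src e ∉ U ∧ N.tgt e ∈ U := by
  induction h with
  | refl => exact absurd hw hv
  | @tail b c _ h ih =>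
    obtain ⟨e, rfl, rfl, he⟩ := h
    by_cases hb : N.src e ∈ U
    · exact ih hb
    · exact ⟨e, he, hb, hw⟩

/-! ### Static flows, summation by parts, thin flows -/

/-- `x` is an `s`-`t`-flow of value `u`. -/
def IsBalanced [Fintype E] [DecidableEq V] (N : Network V E) (u : ℝ) (x : E → ℝ) : Prop :=
  ∀ v, ∑ e with N.src e = v, x e - ∑ e with N.tgt e = v, x e =
    (if v = N.s then u else 0) - (if v = N.t then u else 0)

theorem sum_mul_tgt_sub_src [Fintype V] [Fintype E] [DecidableEq V] (N : Network V E)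
    (x : E → ℝ) (p : V → ℝ) :
    ∑ e, x e * (p (N.tgt e) - p (N.src e)) =
      ∑ v, p v * (∑ e with N.tgt e = v, x e - ∑ e with N.src e = v, x e) := by
  have h : ∀ g : E → V, ∑ e, x e * p (g e) = ∑ v, p v * ∑ e with g e = v, x e := by
    intro g
    rw [← Finset.sum_fiberwise Finset.univ g]
    refine Finset.sum_congr rfl fun v _ => ?_
    rw [Finset.mul_sum]
    refine Finset.sum_congr rfl fun e he => ?_
    rw [(Finset.mem_filter.1 he).2, mul_comm]
  simp only [mul_sub, Finset.sum_sub_distrib, h]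

theorem IsBalanced.sum_mul_sub [Fintype V] [Fintype E] [DecidableEq V] {N : Network V E}
    {u : ℝ} {x : E → ℝ} (h : N.IsBalanced u x) (p : V → ℝ) :
    ∑ e, x e * (p (N.tgt e) - p (N.src e)) = u * (p N.t - p N.s) := by
  rw [sum_mul_tgt_sub_src]
  have h' : ∀ v, p v * (∑ e with N.tgt e = v, x e - ∑ e with N.src e = v, x e) =
      (if v = N.t then u * p v else 0) - (if v = N.s then u * p v else 0) := by
    intro v
    rw [← neg_sub, h v]
    split_ifs <;> ring
  simp only [h', Finset.sum_sub_distrib, Finset.sum_ite_eq',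
    Finset.mem_univ, if_true]
  ring

/-- The normalized thin flow with resetting for the labelling `l`: the node labels `lam` are the
slopes of the arrival time functions, `x` is the corresponding flow on the active arcs. -/
structure IsThinFlow [Fintype E] [DecidableEq V] (N : Network V E) (l lam : V → ℝ)
    (x : E → ℝ) : Prop where
  source : lam N.s = 1
  pos : ∀ v, 0 < lam v
  balanced : N.IsBalanced N.u₀ x
  nonneg : ∀ e, 0 ≤ x e
  le_mul : ∀ e, x e ≤ N.ν e * lam (N.tgt e)
  of_not_isActive : ∀ e, ¬ N.IsActive l e → x e = 0
  of_isResetting : ∀ e, N.IsResetting l e → x e = N.ν e * lam (N.tgt e)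
  of_lt : ∀ e, N.IsActive l e → lam (N.src e) < lam (N.tgt e) → x e = N.ν e * lam (N.tgt e)
  of_gt : ∀ e, ¬ N.IsResetting l e → lam (N.tgt e) < lam (N.src e) → x e = 0
  entering : ∀ w, w ≠ N.s → ∃ e, N.tgt e = w ∧ N.IsActive l e ∧
    (N.IsResetting l e ∨ lam (N.src e) ≤ lam (N.tgt e))

theorem IsResetting.isActive {N : Network V E} {l : V → ℝ} {e : E} (h : N.IsResetting l e) :
    N.IsActive l e := le_of_lt h

/-! ### Smoothed thin flows: a uniform bound and a maximal subsolution -/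

open Classical in
/-- The flow on the arc `e` belonging to the slopes `lam`, with the jump at equal slopes of a
nonresetting arc smoothed out. -/
noncomputable def smoothFlow (N : Network V E) (l : V → ℝ) (n : ℝ) (lam : V → ℝ) (e : E) : ℝ :=
  if N.IsResetting l e then N.ν e * lam (N.tgt e)
  else if N.IsActive l e then
    N.ν e * lam (N.tgt e) * max 0 (min 1 (n * (lam (N.tgt e) - lam (N.src e))))
  else 0

theorem continuous_smoothFlow (N : Network V E) (l : V → ℝ) (n : ℝ) (e : E) :
    Continuous fun lam => N.smoothFlow l n lam e := by
  unfold smoothFlow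
  split_ifs <;> fun_prop

theorem smoothFlow_nonneg (N : Network V E) (l : V → ℝ) (n : ℝ) {lam : V → ℝ} {e : E}
    (h : 0 ≤ lam (N.tgt e)) : 0 ≤ N.smoothFlow l n lam e := by
  have := N.ν_pos e
  unfold smoothFlow
  split_ifs <;> positivity

theorem smoothFlow_le (N : Network V E) (l : V → ℝ) (n : ℝ) {lam : V → ℝ} {e : E}
    (h : 0 ≤ lam (N.tgt e)) : N.smoothFlow l n lam e ≤ N.ν e * lam (N.tgt e) := by
  have h1 : 0 ≤ N.ν e * lam (N.tgt e) := mul_nonneg (N.ν_pos e).le h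
  unfold smoothFlow
  split_ifs
  · exact le_rfl
  · exact mul_le_of_le_one_right h1 (max_le zero_le_one (min_le_left _ _))
  · exact h1

theorem smoothFlow_mono (N : Network V E) (l : V → ℝ) {n : ℝ} (hn : 0 ≤ n) {lam lam' : V → ℝ}
    {e : E} (h : 0 ≤ lam (N.tgt e)) (htgt : lam (N.tgt e) ≤ lam' (N.tgt e))
    (hsrc : lam' (N.src e) ≤ lam (N.src e)) :
    N.smoothFlow l n lam e ≤ N.smoothFlow l n lam' e := by
  have := N.ν_pos e
  unfold smoothFlow
  have := h.trans htgt
  split_ifs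
  · gcongr
  · gcongr
  · exact le_rfl

theorem smoothFlow_eq_of_ge (N : Network V E) (l : V → ℝ) {n : ℝ} {lam : V → ℝ} {e : E}
    (he : N.IsActive l e) (h : 1 ≤ n * (lam (N.tgt e) - lam (N.src e))) :
    N.smoothFlow l n lam e = N.ν e * lam (N.tgt e) := by
  unfold smoothFlow
  split_ifs
  · rfl
  · rw [min_eq_left h, max_eq_right zero_le_one, mul_one]

theorem smoothFlow_eq_zero (N : Network V E) (l : V → ℝ) {n : ℝ} (hn : 0 ≤ n) {lam : V → ℝ}
    {e : E} (he : ¬ N.IsResetting l e) (h : lam (N.tgt e) ≤ lam (N.src e)) :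
    N.smoothFlow l n lam e = 0 := by
  unfold smoothFlow
  rw [if_neg he]
  split_ifs
  · have : n * (lam (N.tgt e) - lam (N.src e)) ≤ 0 :=
      mul_nonpos_of_nonneg_of_nonpos hn (by linarith)
    rw [max_eq_left ((min_le_right _ _).trans this), mul_zero]
  · rfl

/-- The surplus of inflow over outflow and demand at a node, for the smoothed flow. -/
noncomputable def surplus [Fintype E] [DecidableEq V] (N : Network V E) (l : V → ℝ) (n : ℝ)
    (lam : V → ℝ) (w : V) : ℝ :=
  ∑ e with N.tgt e = w, N.smoothFlow l n lam e - ∑ e with N.src e = w, N.smoothFlow l n lam e -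
    if w = N.t then N.u₀ else 0

theorem continuous_surplus [Fintype E] [DecidableEq V] (N : Network V E) (l : V → ℝ) (n : ℝ)
    (w : V) : Continuous fun lam => N.surplus l n lam w := by
  unfold surplus
  have := N.continuous_smoothFlow l n
  fun_prop

/-- Raising the labels of other nodes can only draw more flow out of `u` and push less into it. This
monotonicity drives the maximal subsolution argument. -/
theorem surplus_anti [Fintype E] [DecidableEq V] (N : Network V E) (l : V → ℝ) {n : ℝ}
    (hn : 0 ≤ n) {lam lam' : V → ℝ} (h0 : 0 ≤ lam) (hle : lam ≤ lam') {u : V}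
    (hu : lam u = lam' u) : N.surplus l n lam' u ≤ N.surplus l n lam u := by
  unfold surplus
  refine sub_le_sub_right (sub_le_sub (Finset.sum_le_sum fun e he => ?_)
    (Finset.sum_le_sum fun e he => ?_)) _
  · have he := (Finset.mem_filter.1 he).2
    exact N.smoothFlow_mono l hn ((h0 _).trans (hle _)) (by rw [he, hu]) (hle _)
  · have he := (Finset.mem_filter.1 he).2
    exact N.smoothFlow_mono l hn (h0 _) (hle _) (by rw [he, hu])

/-- Labels cannot skip the range from `β` to `C * β`. Otherwise some active arc enters the set of
labels above `β` and carries more than `ν e * C * β`; the arcs leaving the set carry at most `(∑ ν)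
* β` and the sink absorbs at most `u₀`, too little to balance it. -/
theorem exists_gt_of_surplus_nonpos [Fintype V] [Fintype E] [DecidableEq V] (N : Network V E)
    {l : V → ℝ} (hl : ∀ v, N.ActiveReach l N.s v) {n : ℝ} (hn : 1 ≤ n) {lam : V → ℝ}
    (h0 : 0 ≤ lam) (hs : lam N.s = 1) (hF : ∀ w, w ≠ N.s → N.surplus l n lam w ≤ 0)
    {C β : ℝ} (hC : 2 ≤ C) (hC' : ∀ e, N.u₀ + ∑ e, N.ν e < N.ν e * C) (hβ : 1 ≤ β)
    {w : V} (hw : β < lam w) : ∃ v, β < lam v ∧ lam v ≤ C * β := by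
  classical
  by_contra! hgap
  obtain ⟨e₀, he₀, hsrc, htgt⟩ := exists_enter_of_activeReach (hl w) {v | β < lam v}
    (by simpa [hs] using hβ) hw
  simp only [Set.mem_ofPred_eq, not_lt] at hsrc htgt
  have htgt' := hgap _ htgt
  let p : V → ℝ := fun v => if β < lam v then 1 else 0
  have hsum := N.sum_mul_tgt_sub_src (N.smoothFlow l n lam) p
  have hle : ∑ v, p v * (∑ e with N.tgt e = v, N.smoothFlow l n lam e -
      ∑ e with N.src e = v, N.smoothFlow l n lam e) ≤ N.u₀ := by
    have : N.u₀ = ∑ v, if v = N.t then N.u₀ else 0 := by simp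
    rw [this]
    refine Finset.sum_le_sum fun v _ => ?_
    by_cases hv : β < lam v
    · have hvs : v ≠ N.s := by rintro rfl; linarith
      have := hF v hvs
      unfold surplus at this
      simp only [p, hv, if_true, one_mul]
      linarith
    · simp only [p, hv, if_false, zero_mul]
      have := N.u₀_pos.le
      split_ifs <;> simp [this]
  have hge : ∑ e, (-(N.ν e * β) + if e = e₀ then N.ν e * (C * β) else 0) ≤
      ∑ e, N.smoothFlow l n lam e * (p (N.tgt e) - p (N.src e)) := by
    refine Finset.sum_le_sum fun e _ => ?_
    have hν := N.ν_pos e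
    split_ifs with he
    · subst he
      have hflow : N.smoothFlow l n lam e = N.ν e * lam (N.tgt e) := by
        -- The labels differ by at least `(C - 1) * β ≥ 1` and `n ≥ 1`, so the ramp has reached its
        -- full value.
        refine N.smoothFlow_eq_of_ge l he₀ ?_
        nlinarith
      have h1 : p (N.tgt e) = 1 := if_pos htgt
      have h2 : p (N.src e) = 0 := if_neg (not_lt.2 hsrc)
      rw [hflow, h1, h2]
      nlinarith
    · have hnn := N.smoothFlow_nonneg l n (h0 (N.tgt e))
      have hmul : 0 ≤ N.ν e * β := by positivity
      by_cases h1 : β < lam (N.tgt e) <;> by_cases h2 : β < lam (N.src e) <;>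
        simp only [p, h1, h2, if_true, if_false] <;> try nlinarith
      have := N.smoothFlow_le l n (h0 (N.tgt e))
      nlinarith
  rw [Finset.sum_add_distrib, Finset.sum_ite_eq' Finset.univ e₀, if_pos (Finset.mem_univ _),
    Finset.sum_neg_distrib, ← Finset.sum_mul] at hge
  have hu := N.u₀_pos
  have := hC' e₀
  nlinarith

theorem exists_bound_of_surplus_nonpos [Fintype V] [Fintype E] [DecidableEq V] (N : Network V E)
    {l : V → ℝ} (hl : ∀ v, N.ActiveReach l N.s v) :
    ∃ B : ℝ, ∀ n : ℝ, 1 ≤ n → ∀ lam : V → ℝ, 0 ≤ lam → lam N.s = 1 →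
      (∀ w, w ≠ N.s → N.surplus l n lam w ≤ 0) → ∀ v, lam v ≤ B := by
  classical
  have hu := N.u₀_pos
  have hN : 0 ≤ ∑ e, N.ν e := Finset.sum_nonneg fun e _ => (N.ν_pos e).le
  let C : ℝ := 2 + ∑ e, (N.u₀ + ∑ e, N.ν e) / N.ν e
  have hsum : ∀ e ∈ Finset.univ, 0 ≤ (N.u₀ + ∑ e, N.ν e) / N.ν e := fun e _ =>
    div_nonneg (by linarith) (N.ν_pos e).le
  have hC : 2 ≤ C := le_add_of_nonneg_right (Finset.sum_nonneg hsum)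
  have hC' : ∀ e, N.u₀ + ∑ e, N.ν e < N.ν e * C := by
    intro e
    have h1 : (N.u₀ + ∑ e, N.ν e) / N.ν e < C :=
      lt_of_le_of_lt (Finset.single_le_sum hsum (Finset.mem_univ e)) (by simp [C])
    rwa [div_lt_iff₀' (N.ν_pos e)] at h1
  refine ⟨C ^ Fintype.card V, fun n hn lam h0 hs hF => ?_⟩
  -- Without gaps, each factor `C` picks up at least one further node, until none is left. The
  -- resulting bound does not depend on `n`.
  have key : ∀ k : ℕ, (∀ v, lam v ≤ C ^ k) ∨
      k < (Finset.univ.filter fun v => lam v ≤ C ^ k).card := by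
    intro k
    have hpow : ∀ k : ℕ, 1 ≤ C ^ k := fun k => one_le_pow₀ (by linarith)
    have hmono : ∀ k : ℕ, C ^ k ≤ C ^ (k + 1) := fun k =>
      pow_le_pow_right₀ (by linarith) (Nat.le_succ k)
    induction k with
    | zero =>
      right
      exact Finset.card_pos.2 ⟨N.s, by simp [hs]⟩
    | succ k ih =>
      by_cases hall : ∀ v, lam v ≤ C ^ k
      · exact Or.inl fun v => (hall v).trans (hmono k)
      · right
        have ih := ih.resolve_left hall
        push Not at hall
        obtain ⟨w, hw⟩ := hall
        obtain ⟨v, hv1, hv2⟩ := N.exists_gt_of_surplus_nonpos hl hn h0 hs hF hC hC' (hpow k) hw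
        refine lt_of_le_of_lt ih (Finset.card_lt_card ?_)
        rw [Finset.ssubset_iff_of_subset]
        · exact ⟨v, by simpa [pow_succ'] using hv2, by simpa using hv1⟩
        · intro u hu
          simp only [Finset.mem_filter, Finset.mem_univ, true_and] at hu ⊢
          exact hu.trans (hmono k)
  rcases key (Fintype.card V) with h | h
  · exact h
  · exact absurd h (not_lt.2 (Finset.card_le_univ _))

open Filter Topology

theorem smoothFlow_of_not_isActive (N : Network V E) (l : V → ℝ) (n : ℝ) (lam : V → ℝ) {e : E}
    (he : ¬ N.IsActive l e) : N.smoothFlow l n lam e = 0 := by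
  unfold smoothFlow
  rw [if_neg (fun h => he (IsResetting.isActive h)), if_neg he]

theorem smoothFlow_of_isResetting (N : Network V E) (l : V → ℝ) (n : ℝ) (lam : V → ℝ) {e : E}
    (he : N.IsResetting l e) : N.smoothFlow l n lam e = N.ν e * lam (N.tgt e) := by
  unfold smoothFlow
  rw [if_pos he]

/-- A Perron argument: among the labels with nonpositive surplus off the source, one of maximal sum
has zero surplus, since a node with negative surplus could be raised. -/
theorem exists_smooth_thinFlow [Fintype V] [Fintype E] [DecidableEq V] (N : Network V E)
    {l : V → ℝ} {B : ℝ} {n : ℝ} (hn : 0 ≤ n)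
    (hB : ∀ lam : V → ℝ, 0 ≤ lam → lam N.s = 1 →
      (∀ w, w ≠ N.s → N.surplus l n lam w ≤ 0) → ∀ v, lam v ≤ B) :
    ∃ lam : V → ℝ, (∀ v, 0 ≤ lam v) ∧ (∀ v, lam v ≤ B) ∧ lam N.s = 1 ∧
      (∀ w, w ≠ N.s → N.surplus l n lam w = 0) ∧
      ∀ w, w ≠ N.s → ∃ e, N.tgt e = w ∧ N.IsActive l e ∧
        (N.IsResetting l e ∨ lam (N.src e) ≤ lam (N.tgt e)) := by
  -- The box has room `1` above the a priori bound `B`, so that labels can be raised by up to `1`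
  -- within it.
  let K : Set (V → ℝ) := Set.Icc 0 (fun _ => B + 1) ∩
    ({lam | lam N.s = 1} ∩ ⋂ w : {w // w ≠ N.s}, {lam | N.surplus l n lam w ≤ 0})
  have hK : IsCompact K := by
    refine isCompact_Icc.inter_right (IsClosed.inter ?_ (isClosed_iInter fun w => ?_))
    · exact isClosed_eq (continuous_apply _) continuous_const
    · exact isClosed_le (N.continuous_surplus l n w) continuous_const
  have memK : ∀ lam, lam ∈ K ↔ (0 ≤ lam ∧ ∀ v, lam v ≤ B + 1) ∧ lam N.s = 1 ∧
      ∀ w, w ≠ N.s → N.surplus l n lam w ≤ 0 := by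
    intro lam
    simp [K, Pi.le_def]
  have hleB : ∀ lam ∈ K, ∀ v, lam v ≤ B := fun lam hlam =>
    hB lam ((memK lam).1 hlam).1.1 ((memK lam).1 hlam).2.1 ((memK lam).1 hlam).2.2
  have hne : K.Nonempty := by
    have h0 : (0 : V → ℝ) ≤ Pi.single N.s 1 := by
      intro v; by_cases h : v = N.s <;> simp [h]
    have h1 : (Pi.single N.s 1 : V → ℝ) N.s = 1 := by simp
    have h2 : ∀ w, w ≠ N.s → N.surplus l n (Pi.single N.s 1) w ≤ 0 := by
      intro w hw
      unfold surplus
      have hin : ∑ e with N.tgt e = w, N.smoothFlow l n (Pi.single N.s 1) e ≤ 0 := by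
        refine Finset.sum_nonpos fun e he => ?_
        have he := (Finset.mem_filter.1 he).2
        refine (N.smoothFlow_le l n (h0 _)).trans ?_
        rw [he, Pi.single_eq_of_ne hw, mul_zero]
      have hout : 0 ≤ ∑ e with N.src e = w, N.smoothFlow l n (Pi.single N.s 1) e :=
        Finset.sum_nonneg fun e _ => N.smoothFlow_nonneg l n (h0 _)
      have := N.u₀_pos
      split_ifs <;> linarith
    refine ⟨Pi.single N.s 1, (memK _).2 ⟨⟨h0, fun v => ?_⟩, h1, h2⟩⟩
    exact (hB _ h0 h1 h2 v).trans (by linarith)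
  obtain ⟨lam, hlam, hmax⟩ := hK.exists_isMaxOn hne
    (f := fun lam : V → ℝ => ∑ v, lam v) (by fun_prop)
  have hlamK := (memK lam).1 hlam
  have h0 : 0 ≤ lam := hlamK.1.1
  have hraise : ∀ w, w ≠ N.s → ∀ η : ℝ, 0 < η → η ≤ 1 →
      ¬ N.surplus l n (Function.update lam w (lam w + η)) w ≤ 0 := by
    intro w hw η hη hη1 hsur
    have hle : lam ≤ Function.update lam w (lam w + η) := by
      intro v
      by_cases hv : v = w
      · subst hv; simp [hη.le]
      · simp [hv]
    have hmem : Function.update lam w (lam w + η) ∈ K := by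
      refine (memK _).2 ⟨⟨h0.trans hle, fun v => ?_⟩, ?_, fun u hu => ?_⟩
      · have hb := hleB lam hlam
        by_cases hv : v = w
        · subst hv; simpa using add_le_add (hb v) hη1
        · simpa [hv] using (hb v).trans (by linarith)
      · rw [Function.update_of_ne hw.symm]; exact hlamK.2.1
      · by_cases huw : u = w
        · subst huw; exact hsur
        · refine (N.surplus_anti l hn h0 hle ?_).trans (hlamK.2.2 u hu)
          simp [huw]
    have hm : ∑ v, Function.update lam w (lam w + η) v ≤ ∑ v, lam v := hmax hmem
    refine absurd hm (not_le.2 (Finset.sum_lt_sum (fun v _ => hle v) ⟨w, Finset.mem_univ _, ?_⟩))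
    simp [hη]
  refine ⟨lam, h0, hleB lam hlam, hlamK.2.1, fun w hw => ?_, fun w hw => ?_⟩
  · refine le_antisymm (hlamK.2.2 w hw) (not_lt.1 fun hlt => ?_)
    have hc : Continuous fun η : ℝ =>
        N.surplus l n (Function.update lam w (lam w + η)) w :=
      (N.continuous_surplus l n w).comp
        (continuous_const.update w (continuous_const.add continuous_id))
    have hev : ∀ᶠ η in 𝓝[>] (0 : ℝ),
        N.surplus l n (Function.update lam w (lam w + η)) w < 0 := by
      refine (hc.tendsto 0).mono_left nhdsWithin_le_nhds |>.eventually_lt_const ?_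
      simpa using hlt
    obtain ⟨η, h1, h2, h3⟩ := (hev.and (Ioc_mem_nhdsGT (zero_lt_one' ℝ))).exists
    exact hraise w hw η h2 h3 h1.le
  -- If every active arc into `w` is nonresetting with a strictly larger label at its tail, a small
  -- raise of `w` leaves the inflow at zero, so the surplus stays nonpositive and maximality is
  -- violated.
  · by_contra! hcon
    have hev : ∀ᶠ η in 𝓝[>] (0 : ℝ), ∀ e, N.tgt e = w → N.IsActive l e →
        lam w + η ≤ lam (N.src e) := by
      refine eventually_all.2 fun e => ?_
      by_cases he : N.tgt e = w ∧ N.IsActive l e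
      · obtain ⟨rfl, hact⟩ := he
        have hlt := (hcon e rfl hact).2
        have : Tendsto (fun η : ℝ => lam (N.tgt e) + η) (𝓝[>] 0) (𝓝 (lam (N.tgt e) + 0)) :=
          (tendsto_const_nhds.add tendsto_id).mono_left nhdsWithin_le_nhds
        filter_upwards [this.eventually_lt_const (by simpa using hlt)] with η hη _ _
        exact hη.le
      · exact Eventually.of_forall fun η h1 h2 => absurd ⟨h1, h2⟩ he
    obtain ⟨η, h1, h2, h3⟩ := (hev.and (Ioc_mem_nhdsGT (zero_lt_one' ℝ))).exists
    refine hraise w hw η h2 h3 ?_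
    set lam' := Function.update lam w (lam w + η) with hlam'
    have hin : ∑ e with N.tgt e = w, N.smoothFlow l n lam' e = 0 := by
      refine Finset.sum_eq_zero fun e he => ?_
      have he := (Finset.mem_filter.1 he).2
      by_cases hact : N.IsActive l e
      · obtain ⟨hnr, hlt⟩ := hcon e he hact
        refine N.smoothFlow_eq_zero l hn hnr ?_
        have hne : N.src e ≠ w := by rintro hh; rw [hh, he] at hlt; exact lt_irrefl _ hlt
        rw [hlam', he, Function.update_self, Function.update_of_ne hne]
        exact h1 e he hact
      · exact N.smoothFlow_of_not_isActive l n lam' hact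
    have hout : 0 ≤ ∑ e with N.src e = w, N.smoothFlow l n lam' e := by
      refine Finset.sum_nonneg fun e _ => N.smoothFlow_nonneg l n ?_
      by_cases hv : N.tgt e = w
      · rw [hlam', hv, Function.update_self]; have : 0 ≤ lam w := h0 w; linarith
      · rw [hlam', Function.update_of_ne hv]; exact h0 _
    unfold surplus
    rw [hin]
    have := N.u₀_pos
    split_ifs <;> linarith

/-- Flow conservation at all nodes but one implies flow conservation. -/
theorem isBalanced_of_ne [Fintype V] [Fintype E] [DecidableEq V] (N : Network V E) {u : ℝ}
    {x : E → ℝ} (v₀ : V) (h : ∀ v, v ≠ v₀ → ∑ e with N.src e = v, x e -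
      ∑ e with N.tgt e = v, x e = (if v = N.s then u else 0) - (if v = N.t then u else 0)) :
    N.IsBalanced u x := by
  have htot := N.sum_mul_tgt_sub_src x (fun _ => -1)
  have htot' : ∑ v, ((if v = N.s then u else 0) - (if v = N.t then u else 0)) = 0 := by simp
  simp only [sub_self, mul_zero, Finset.sum_const_zero, neg_mul, one_mul, neg_sub] at htot
  intro v
  by_cases hv : v = v₀
  · subst hv
    rw [← Finset.add_sum_erase _ _ (Finset.mem_univ v)] at htot htot'
    rw [Finset.sum_congr rfl (fun w hw => h w (Finset.ne_of_mem_erase hw))] at htot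
    linarith
  · exact h v hv

theorem isBalanced_smoothFlow [Fintype V] [Fintype E] [DecidableEq V] (N : Network V E)
    {l lam : V → ℝ} {n : ℝ} (h : ∀ w, w ≠ N.s → N.surplus l n lam w = 0) :
    N.IsBalanced N.u₀ (N.smoothFlow l n lam) := by
  -- Nothing is known about the surplus at the source, but global conservation supplies its balance.
  refine N.isBalanced_of_ne N.s fun v hv => ?_
  have := h v hv
  unfold surplus at this
  rw [if_neg hv]
  linarith

/-- The net flow into a node set without the source is the flow absorbed there. -/
theorem IsBalanced.sum_cut [Fintype V] [Fintype E] [DecidableEq V] {N : Network V E}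
    {u : ℝ} {x : E → ℝ} (h : N.IsBalanced u x) (U : Set V) [DecidablePred (· ∈ U)]
    (hs : N.s ∉ U) :
    ∑ e, x e * ((if N.tgt e ∈ U then 1 else 0) - (if N.src e ∈ U then 1 else 0)) =
      if N.t ∈ U then u else 0 := by
  have := h.sum_mul_sub (fun v => if v ∈ U then 1 else 0)
  rw [this, if_neg hs]
  split_ifs <;> simp

/-! ### Existence of thin flows: the limit of steep ramps -/

/-- Every feasible labelling admits a thin flow with resetting. -/
theorem exists_isThinFlow [Fintype V] [Fintype E] [DecidableEq V] (N : Network V E)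
    {l : V → ℝ} (hl : l ∈ N.feasibleLabellings) :
    ∃ (lam : V → ℝ) (x : E → ℝ), N.IsThinFlow l lam x := by
  classical
  obtain ⟨hreach, hlive⟩ := hl
  obtain ⟨B, hB⟩ := N.exists_bound_of_surplus_nonpos hreach
  have hn1 : ∀ k : ℕ, (1 : ℝ) ≤ (k : ℝ) + 1 := fun k => by
    have := Nat.cast_nonneg (α := ℝ) k; linarith
  have hn0 : ∀ k : ℕ, (0 : ℝ) ≤ (k : ℝ) + 1 := fun k => zero_le_one.trans (hn1 k)
  choose L hL0 hLB hLs hLsur hLent using fun k : ℕ =>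
    N.exists_smooth_thinFlow (l := l) (hn0 k) (hB _ (hn1 k))
  let Y : ℕ → E → ℝ := fun k => N.smoothFlow l ((k : ℝ) + 1) (L k)
  have hmem : ∀ k, (L k, Y k) ∈ Set.Icc (0 : V → ℝ) (fun _ => B) ×ˢ
      Set.Icc (0 : E → ℝ) (fun e => N.ν e * B) := by
    intro k
    refine ⟨⟨hL0 k, hLB k⟩, fun e => N.smoothFlow_nonneg _ _ (hL0 k _), fun e => ?_⟩
    exact (N.smoothFlow_le _ _ (hL0 k _)).trans
      (mul_le_mul_of_nonneg_left (hLB k _) (N.ν_pos e).le)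
  obtain ⟨⟨lam, x⟩, -, φ, hφ, hlim⟩ := (isCompact_Icc.prod isCompact_Icc).tendsto_subseq hmem
  have hlam : ∀ v, Tendsto (fun k => L (φ k) v) atTop (𝓝 (lam v)) := fun v =>
    ((continuous_apply v).comp continuous_fst).continuousAt.tendsto.comp hlim
  have hx : ∀ e, Tendsto (fun k => Y (φ k) e) atTop (𝓝 (x e)) := fun e =>
    ((continuous_apply e).comp continuous_snd).continuousAt.tendsto.comp hlim
  have hlam0 : ∀ v, 0 ≤ lam v := fun v => ge_of_tendsto' (hlam v) fun k => hL0 _ v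
  have hx0 : ∀ e, 0 ≤ x e := fun e =>
    ge_of_tendsto' (hx e) fun k => N.smoothFlow_nonneg _ _ (hL0 _ _)
  have hxle : ∀ e, x e ≤ N.ν e * lam (N.tgt e) := fun e =>
    le_of_tendsto_of_tendsto' (hx e) ((hlam _).const_mul _) fun k =>
      N.smoothFlow_le _ _ (hL0 _ _)
  have hbal : N.IsBalanced N.u₀ x := by
    intro v
    have h1 : Tendsto (fun k => ∑ e with N.src e = v, Y (φ k) e -
        ∑ e with N.tgt e = v, Y (φ k) e) atTop
        (𝓝 (∑ e with N.src e = v, x e - ∑ e with N.tgt e = v, x e)) :=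
      (tendsto_finsetSum _ fun e _ => hx e).sub (tendsto_finsetSum _ fun e _ => hx e)
    refine tendsto_nhds_unique h1 (tendsto_const_nhds.congr fun k => ?_)
    exact (N.isBalanced_smoothFlow (hLsur (φ k)) v).symm
  have hcast : Tendsto (fun k => ((φ k : ℕ) : ℝ) + 1) atTop atTop :=
    tendsto_atTop_add_const_right _ _ (tendsto_natCast_atTop_atTop.comp hφ.tendsto_atTop)
  have hreset : ∀ e, N.IsResetting l e → x e = N.ν e * lam (N.tgt e) := fun e he =>
    tendsto_nhds_unique (hx e) (((hlam _).const_mul _).congr fun k =>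
      (N.smoothFlow_of_isResetting _ _ _ he).symm)
  have hup : ∀ e, N.IsActive l e → lam (N.src e) < lam (N.tgt e) →
      x e = N.ν e * lam (N.tgt e) := by
    intro e he hlt
    refine tendsto_nhds_unique_of_eventuallyEq (hx e) ((hlam _).const_mul _) ?_
    have hdiff := hcast.atTop_mul_pos (sub_pos.2 hlt) ((hlam (N.tgt e)).sub (hlam (N.src e)))
    filter_upwards [hdiff.eventually_ge_atTop 1] with k hk
    exact N.smoothFlow_eq_of_ge l he hk
  have hent : ∀ w, w ≠ N.s → ∃ e, N.tgt e = w ∧ N.IsActive l e ∧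
      (N.IsResetting l e ∨ lam (N.src e) ≤ lam (N.tgt e)) := by
    intro w hw
    by_contra! hcon
    have hev : ∀ᶠ k in atTop, ∀ e, N.tgt e = w → N.IsActive l e →
        L (φ k) (N.tgt e) < L (φ k) (N.src e) := by
      refine eventually_all.2 fun e => ?_
      by_cases he : N.tgt e = w ∧ N.IsActive l e
      · filter_upwards [(hlam _).eventually_lt (hlam _) (hcon e he.1 he.2).2] with k hk _ _
        exact hk
      · exact Eventually.of_forall fun η h1 h2 => absurd ⟨h1, h2⟩ he
    obtain ⟨k, hk⟩ := hev.exists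
    obtain ⟨e, h1, h2, h3⟩ := hLent (φ k) w hw
    rcases h3 with h3 | h3
    · exact (hcon e h1 h2).1 h3
    · exact absurd h3 (not_le.2 (hk e h1 h2))
  have hs : lam N.s = 1 := tendsto_nhds_unique (hlam N.s) (by simp [hLs])
  have hinact : ∀ e, ¬ N.IsActive l e → x e = 0 := fun e he =>
    tendsto_nhds_unique (hx e) (tendsto_const_nhds.congr fun k =>
      (N.smoothFlow_of_not_isActive _ _ _ he).symm)
  refine ⟨lam, x, hs, fun v => ?_, hbal, hx0, hxle, hinact, hreset, hup, ?_, hent⟩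
  -- Positivity is where feasibility enters. No flow enters the zero set `U` of `lam`, so the sink
  -- is outside and no flow leaves `U`. An active arc leaving `U` would be saturated at positive
  -- rate; thus `U` is closed under active arcs.
  · refine (hlam0 v).lt_of_ne' fun hv => ?_
    let U : Set V := {v | lam v = 0}
    have hsU : N.s ∉ U := by simp [U, hs]
    have hcut := hbal.sum_cut U hsU
    have hterm : ∀ e ∈ Finset.univ,
        x e * ((if N.tgt e ∈ U then (1 : ℝ) else 0) - (if N.src e ∈ U then 1 else 0)) ≤ 0 := by
      intro e _
      by_cases htgt : N.tgt e ∈ U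
      · have : x e = 0 := le_antisymm ((hxle e).trans (by simp [show lam _ = 0 from htgt])) (hx0 e)
        simp [this]
      · rw [if_neg htgt]
        have := hx0 e
        split_ifs <;> simp [this]
    have hsum := Finset.sum_nonpos hterm
    have htU : N.t ∉ U := by
      intro ht
      rw [if_pos ht] at hcut
      have := N.u₀_pos
      linarith
    rw [if_neg htU] at hcut
    have hclosed : ∀ e, N.IsActive l e → N.src e ∈ U → N.tgt e ∈ U := by
      intro e he hsrc
      by_contra htgt
      have h0 := (Finset.sum_eq_zero_iff_of_nonpos hterm).1 hcut e (Finset.mem_univ _)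
      rw [if_neg htgt, if_pos hsrc] at h0
      have hx0' : x e = 0 := by linarith
      have hpos : 0 < lam (N.tgt e) := (hlam0 _).lt_of_ne' htgt
      rw [hup e he (by rw [show lam _ = 0 from hsrc]; exact hpos)] at hx0'
      exact (mul_pos (N.ν_pos e) hpos).ne' hx0'
    -- The head of a resetting arc reaches the sink, which a closed set avoiding the sink excludes.
    -- So the arcs provided by `hent` lead back inside `U`, and descending ranks end in a
    -- contradiction.
    have hnoreset : ∀ e, N.tgt e ∈ U → ¬ N.IsResetting l e := by
      intro e he hr
      obtain ⟨e', h1, h2, h3⟩ := exists_enter_of_activeReach (hlive e hr) Uᶜ (by simpa using he)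
        htU
      exact h3 (hclosed e' h1 (not_not.1 h2))
    obtain ⟨r, -, hr⟩ := N.exists_rank l
    have hnone : ∀ n v, r v = n → v ∉ U := by
      intro n
      induction n using Nat.strong_induction_on with
      | _ n ih =>
        rintro v hv hvU
        have hvs : v ≠ N.s := by rintro rfl; exact hsU hvU
        obtain ⟨e, rfl, h2, h3⟩ := hent v hvs
        have h3 := h3.resolve_left (hnoreset e hvU)
        rw [show lam (N.tgt e) = 0 from hvU] at h3
        exact ih _ (hv ▸ hr e h2) _ rfl (le_antisymm h3 (hlam0 _))
    exact hnone _ v rfl hv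
  · intro e he hlt
    refine tendsto_nhds_unique_of_eventuallyEq (hx e) tendsto_const_nhds ?_
    filter_upwards [(hlam _).eventually_lt (hlam _) hlt] with k hk
    exact N.smoothFlow_eq_zero l (hn0 _) he hk.le

/-! ### Trajectories and their slopes -/

open Set
open scoped NNReal

/-- Arrival time functions `l` together with the cumulative flows `X` on the arcs, both
parametrized by the particles, as they arise from a Nash flow over time. -/
structure IsTrajectory [Fintype E] [DecidableEq V] (N : Network V E) (l : V → ℝ → ℝ)
    (X : E → ℝ → ℝ) : Prop where
  source : ∀ θ, 0 ≤ θ → l N.s θ = l N.s 0 + θ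
  monotoneOn : ∀ v, MonotoneOn (l v) (Ici 0)
  lipschitz : ∃ K : ℝ≥0, ∀ v, LipschitzOnWith K (l v) (Ici 0)
  flow_monotoneOn : ∀ e, MonotoneOn (X e) (Ici 0)
  flow_le : ∀ e a b, 0 ≤ a → a ≤ b → X e b - X e a ≤ N.ν e * (l (N.tgt e) b - l (N.tgt e) a)
  balanced : ∀ θ, 0 ≤ θ → N.IsBalanced (N.u₀ * θ) fun e => X e θ
  of_isResetting : ∀ e a b, 0 ≤ a → a ≤ b → (∀ θ ∈ Icc a b, N.IsResetting (fun v => l v θ) e) →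
    X e b - X e a = N.ν e * (l (N.tgt e) b - l (N.tgt e) a)
  of_not_isActive : ∀ e a b, 0 ≤ a → a ≤ b → (∀ θ ∈ Icc a b, ¬ N.IsActive (fun v => l v θ) e) →
    X e b = X e a
  entering : ∀ w, w ≠ N.s → ∀ θ, 0 ≤ θ → ∃ e, N.tgt e = w ∧ N.IsActive (fun v => l v θ) e

/-- Slopes `l'` of the arrival time functions and flow rates `x'` at `θ`. -/
structure IsSlope [Fintype E] [DecidableEq V] (N : Network V E) (l : V → ℝ → ℝ)
    (θ : ℝ) (l' : V → ℝ) (x' : E → ℝ) : Prop where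
  hasDerivAt : ∀ v, HasDerivAt (l v) (l' v) θ
  nonneg : ∀ v, 0 ≤ l' v
  source : l' N.s = 1
  balanced : N.IsBalanced N.u₀ x'
  flow_nonneg : ∀ e, 0 ≤ x' e
  flow_le : ∀ e, x' e ≤ N.ν e * l' (N.tgt e)
  of_isResetting : ∀ e, N.IsResetting (fun v => l v θ) e → x' e = N.ν e * l' (N.tgt e)
  of_not_isActive : ∀ e, ¬ N.IsActive (fun v => l v θ) e → x' e = 0
  of_tie : ∀ e, N.IsActive (fun v => l v θ) e → ¬ N.IsResetting (fun v => l v θ) e →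
    l' (N.tgt e) = l' (N.src e)
  hasDerivAt_queue : ∀ e,
    (N.IsResetting (fun v => l v θ) e →
      HasDerivAt (fun θ => max 0 (l (N.tgt e) θ - l (N.src e) θ - N.τ e))
        (l' (N.tgt e) - l' (N.src e)) θ) ∧
    (¬ N.IsResetting (fun v => l v θ) e →
      HasDerivAt (fun θ => max 0 (l (N.tgt e) θ - l (N.src e) θ - N.τ e)) 0 θ)

theorem _root_.LipschitzOnWith.ae_differentiableAt_Ioi {f : ℝ → ℝ} {K : ℝ≥0} {a : ℝ}
    (hf : LipschitzOnWith K f (Ici a)) :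
    ∀ᵐ x ∂(volume : Measure ℝ), a < x → DifferentiableAt ℝ f x := by
  filter_upwards [hf.ae_differentiableWithinAt_of_mem_real] with x hx hax
  exact (hx hax.le).differentiableAt (Ici_mem_nhds hax)

theorem _root_.HasDerivAt.nonneg_of_monotoneOn {f : ℝ → ℝ} {f' x : ℝ} {s : Set ℝ}
    (hf : HasDerivAt f f' x) (hmono : MonotoneOn f s) (hs : s ∈ 𝓝 x) : 0 ≤ f' := by
  have h1 : derivWithin f s x = f' := hf.hasDerivWithinAt.derivWithin
    (uniqueDiffWithinAt_of_mem_nhds hs)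
  rw [← h1]
  exact hmono.derivWithin_nonneg

theorem IsTrajectory.continuousOn [Fintype E] [DecidableEq V] {N : Network V E}
    {l : V → ℝ → ℝ} {X : E → ℝ → ℝ} (h : N.IsTrajectory l X) (v : V) :
    ContinuousOn (l v) (Ici 0) := by
  obtain ⟨K, hK⟩ := h.lipschitz
  exact (hK v).continuousOn

theorem IsTrajectory.flow_lipschitz [Fintype E] [DecidableEq V] {N : Network V E}
    {l : V → ℝ → ℝ} {X : E → ℝ → ℝ} (h : N.IsTrajectory l X) (e : E) :
    ∃ K : ℝ≥0, LipschitzOnWith K (X e) (Ici 0) := by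
  obtain ⟨K, hK⟩ := h.lipschitz
  refine ⟨(N.ν e).toNNReal * K, LipschitzOnWith.of_le_add_mul _ fun a ha b hb => ?_⟩
  rw [NNReal.coe_mul, Real.coe_toNNReal _ (N.ν_pos e).le]
  have hν := N.ν_pos e
  rcases le_total a b with hab | hab
  · have := h.flow_monotoneOn e ha hb hab
    have : 0 ≤ N.ν e * K * dist a b := by positivity
    linarith
  · have h1 := h.flow_le e b a hb hab
    have h2 := (le_abs_self _).trans ((Real.dist_eq _ _).symm.le.trans
      ((hK (N.tgt e)).dist_le_mul a ha b hb))
    nlinarith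

/-- Lipschitz functions are differentiable almost everywhere. Including the positive and negative
parts of the gap `l w - l v - τ e` among them settles the arcs with zero gap: both parts are minimal
there, so both derivatives vanish, and hence so does that of the gap. -/
theorem IsTrajectory.ae_exists_isSlope [Fintype V] [Fintype E] [DecidableEq V] {N : Network V E}
    {l : V → ℝ → ℝ} {X : E → ℝ → ℝ} (h : N.IsTrajectory l X) :
    ∀ᵐ θ ∂(volume : Measure ℝ), 0 < θ → ∃ l' x', N.IsSlope l θ l' x' := by
  obtain ⟨K, hK⟩ := h.lipschitz
  choose KX hKX using h.flow_lipschitz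
  have hgap : ∀ e, LipschitzOnWith (K + K)
      (fun θ => l (N.tgt e) θ - l (N.src e) θ - N.τ e) (Ici 0) := by
    intro e
    simpa using ((hK (N.tgt e)).sub (hK (N.src e))).sub
      (LipschitzWith.const (N.τ e)).lipschitzOnWith
  have hpos : ∀ e, LipschitzOnWith (K + K)
      (fun θ => max 0 (l (N.tgt e) θ - l (N.src e) θ - N.τ e)) (Ici 0) := by
    intro e
    have := (LipschitzWith.id.const_max (0 : ℝ)).comp_lipschitzOnWith (hgap e)
    simpa [Function.comp_def] using this
  have hneg : ∀ e, LipschitzOnWith (K + K)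
      (fun θ => max 0 (-(l (N.tgt e) θ - l (N.src e) θ - N.τ e))) (Ici 0) := by
    intro e
    have := (LipschitzWith.id.const_max (0 : ℝ)).comp_lipschitzOnWith (hgap e).neg
    simpa [Function.comp_def] using this
  have a1 := ae_all_iff.2 fun v => (hK v).ae_differentiableAt_Ioi
  have a2 := ae_all_iff.2 fun e => (hKX e).ae_differentiableAt_Ioi
  have a3 := ae_all_iff.2 fun e => (hpos e).ae_differentiableAt_Ioi
  have a4 := ae_all_iff.2 fun e => (hneg e).ae_differentiableAt_Ioi
  filter_upwards [a1, a2, a3, a4] with θ b1 b2 b3 b4 hθ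
  have hIci : Ici (0 : ℝ) ∈ 𝓝 θ := Ici_mem_nhds hθ
  have d1 : ∀ v, HasDerivAt (l v) (deriv (l v) θ) θ := fun v => (b1 v hθ).hasDerivAt
  have d2 : ∀ e, HasDerivAt (X e) (deriv (X e) θ) θ := fun e => (b2 e hθ).hasDerivAt
  have hg : ∀ e, HasDerivAt (fun θ => l (N.tgt e) θ - l (N.src e) θ - N.τ e)
      (deriv (l (N.tgt e)) θ - deriv (l (N.src e)) θ) θ := fun e =>
    ((d1 _).sub (d1 _)).sub_const _
  have hmin : ∀ (f : ℝ → ℝ), f θ ≤ 0 → DifferentiableAt ℝ (fun θ => max 0 (f θ)) θ →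
      HasDerivAt (fun θ => max 0 (f θ)) 0 θ := by
    intro f hf hd
    have hloc : IsLocalMin (fun θ => max 0 (f θ)) θ := by
      refine Eventually.of_forall fun y => ?_
      simp only [max_eq_left hf]
      exact le_max_left _ _
    simpa [hloc.deriv_eq_zero] using hd.hasDerivAt
  -- The trajectory axioms speak of intervals, so the status of an arc is needed on the whole
  -- interval between `y` and `θ`, on either side.
  have hball : ∀ P : ℝ → Prop, (∀ᶠ y in 𝓝 θ, P y) →
      ∀ᶠ y in 𝓝 θ, 0 ≤ min y θ ∧ ∀ z ∈ Icc (min y θ) (max y θ), P z := by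
    intro P hP
    obtain ⟨ε, hε, hb⟩ := Metric.eventually_nhds_iff.1 (hP.and hIci)
    filter_upwards [Metric.ball_mem_nhds θ hε] with y hy
    rw [Metric.mem_ball, Real.dist_eq, abs_lt] at hy
    have hz : ∀ z ∈ Icc (min y θ) (max y θ), P z ∧ z ∈ Ici (0 : ℝ) := by
      rintro z ⟨h1, h2⟩
      refine hb ?_
      rw [Real.dist_eq, abs_lt]
      rcases le_total y θ with hyθ | hyθ
      · rw [min_eq_left hyθ] at h1; rw [max_eq_right hyθ] at h2
        constructor <;> linarith
      · rw [min_eq_right hyθ] at h1; rw [max_eq_left hyθ] at h2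
        constructor <;> linarith
    exact ⟨(hz _ ⟨le_rfl, min_le_max⟩).2, fun z h => (hz z h).1⟩
  have htie : ∀ e, N.IsActive (fun v => l v θ) e → ¬ N.IsResetting (fun v => l v θ) e →
      deriv (l (N.tgt e)) θ = deriv (l (N.src e)) θ := by
    intro e h1 h2
    simp only [IsActive, IsResetting, not_lt] at h1 h2
    have p1 := hmin (fun θ => l (N.tgt e) θ - l (N.src e) θ - N.τ e) (by linarith) (b3 e hθ)
    have p2 := hmin (fun θ => -(l (N.tgt e) θ - l (N.src e) θ - N.τ e)) (by linarith) (b4 e hθ)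
    have p3 : HasDerivAt (fun θ => l (N.tgt e) θ - l (N.src e) θ - N.τ e) (0 - 0) θ := by
      refine (p1.sub p2).congr_of_eventuallyEq (Eventually.of_forall fun y => ?_)
      simp only [Pi.sub_apply]
      rcases le_total 0 (l (N.tgt e) y - l (N.src e) y - N.τ e) with hy | hy
      · rw [max_eq_right hy, max_eq_left (by linarith)]; ring
      · rw [max_eq_left hy, max_eq_right (by linarith)]; ring
    have := (hg e).unique p3
    linarith
  have hevr : ∀ e, N.IsResetting (fun v => l v θ) e →
      ∀ᶠ y in 𝓝 θ, N.IsResetting (fun v => l v y) e := by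
    intro e he
    exact ((d1 (N.src e)).continuousAt.tendsto.add_const (N.τ e)).eventually_lt
      (d1 (N.tgt e)).continuousAt.tendsto he
  refine ⟨fun v => deriv (l v) θ, fun e => deriv (X e) θ, d1,
    fun v => (d1 v).nonneg_of_monotoneOn (h.monotoneOn v) hIci, ?_, ?_,
    fun e => (d2 e).nonneg_of_monotoneOn (h.flow_monotoneOn e) hIci, ?_, ?_, ?_, htie, ?_⟩
  · refine (d1 N.s).unique
      (((hasDerivAt_id θ).const_add (l N.s 0)).congr_of_eventuallyEq ?_)
    filter_upwards [hIci] with y hy using h.source y hy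
  · intro v
    have e1 : HasDerivAt (fun θ => ∑ e with N.src e = v, X e θ - ∑ e with N.tgt e = v, X e θ)
        (∑ e with N.src e = v, deriv (X e) θ - ∑ e with N.tgt e = v, deriv (X e) θ) θ :=
      (HasDerivAt.fun_sum fun e _ => d2 e).sub (HasDerivAt.fun_sum fun e _ => d2 e)
    refine e1.unique ?_
    have e2 : HasDerivAt (fun θ => ((if v = N.s then N.u₀ else 0) -
        (if v = N.t then N.u₀ else 0)) * θ)
        ((if v = N.s then N.u₀ else 0) - (if v = N.t then N.u₀ else 0)) θ := by
      simpa using (hasDerivAt_id θ).const_mul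
        ((if v = N.s then N.u₀ else 0) - (if v = N.t then N.u₀ else 0))
    refine e2.congr_of_eventuallyEq ?_
    filter_upwards [hIci] with y hy
    rw [h.balanced y hy v]
    split_ifs <;> ring
  · intro e
    have hmono : MonotoneOn (fun θ => N.ν e * l (N.tgt e) θ - X e θ) (Ici 0) := by
      intro a ha b hb hab
      have := h.flow_le e a b ha hab
      simp only
      linarith
    have := (((d1 (N.tgt e)).const_mul (N.ν e)).sub (d2 e)).nonneg_of_monotoneOn hmono hIci
    linarith
  · intro e he
    have hc : (fun y => X e y) =ᶠ[𝓝 θ]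
        fun y => N.ν e * l (N.tgt e) y + (X e θ - N.ν e * l (N.tgt e) θ) := by
      filter_upwards [hball _ (hevr e he)] with y ⟨h0, hy⟩
      have := h.of_isResetting e _ _ h0 min_le_max hy
      rcases le_total y θ with hyθ | hyθ
      · rw [min_eq_left hyθ, max_eq_right hyθ] at this; linarith
      · rw [min_eq_right hyθ, max_eq_left hyθ] at this; linarith
    exact (d2 e).unique ((((d1 (N.tgt e)).const_mul (N.ν e)).add_const _).congr_of_eventuallyEq hc)
  · intro e he
    have hev : ∀ᶠ y in 𝓝 θ, ¬ N.IsActive (fun v => l v y) e := by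
      simp only [IsActive, not_le] at he ⊢
      exact (d1 (N.tgt e)).continuousAt.tendsto.eventually_lt
        ((d1 (N.src e)).continuousAt.tendsto.add_const (N.τ e)) he
    have hc : (fun y => X e y) =ᶠ[𝓝 θ] fun _ => X e θ := by
      filter_upwards [hball _ hev] with y ⟨h0, hy⟩
      have := h.of_not_isActive e _ _ h0 min_le_max hy
      rcases le_total y θ with hyθ | hyθ
      · rw [min_eq_left hyθ, max_eq_right hyθ] at this; exact this.symm
      · rw [min_eq_right hyθ, max_eq_left hyθ] at this; exact this
    exact (d2 e).unique ((hasDerivAt_const θ _).congr_of_eventuallyEq hc)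
  · intro e
    refine ⟨fun he => (hg e).congr_of_eventuallyEq ?_, fun he => hmin _ ?_ (b3 e hθ)⟩
    · filter_upwards [hevr e he] with y hy
      simp only [IsResetting] at hy
      exact max_eq_right (by linarith)
    · simp only [IsResetting, not_lt] at he
      linarith

/-! ### The potential argument -/

/-- A form of `a - b ≤ a * (log a - log b)` valid at zero. The cutoff `ε` is needed because slopes
of arrival times may vanish. -/
theorem sub_sub_le_mul_log_max {a b ε : ℝ} (ha : 0 ≤ a) (hb : 0 ≤ b) (hε : 0 < ε) :
    a - b - ε ≤ a * (Real.log (max a ε) - Real.log (max b ε)) := by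
  have hA : 0 < max a ε := lt_max_of_lt_right hε
  have hB : 0 < max b ε := lt_max_of_lt_right hε
  have h1 : 1 - max b ε / max a ε ≤ Real.log (max a ε) - Real.log (max b ε) := by
    have := Real.one_sub_inv_le_log_of_pos (div_pos hA hB)
    rwa [inv_div, Real.log_div hA.ne' hB.ne'] at this
  have h2 : a * (max b ε / max a ε) ≤ max b ε := by
    rw [mul_div_assoc', div_le_iff₀ hA, mul_comm]
    exact mul_le_mul_of_nonneg_left (le_max_left _ _) hB.le
  have h3 : max b ε ≤ b + ε := max_le (by linarith) (by linarith)
  nlinarith [mul_le_mul_of_nonneg_left h1 ha]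

open Classical in
/-- The contribution of the arc `e` to the potential that shows that arrival times grow with the
slopes `lam` of the thin flow for `l₀`. -/
noncomputable def arcPotential (N : Network V E) (l₀ lam : V → ℝ) (l : V → ℝ → ℝ) (e : E)
    (θ : ℝ) : ℝ :=
  if N.IsResetting l₀ e then
    (l (N.tgt e) θ - l₀ (N.tgt e)) -
      lam (N.tgt e) / lam (N.src e) * (l (N.src e) θ - l₀ (N.src e))
  else if N.IsActive l₀ e then
    max 0 (l (N.tgt e) θ - l (N.src e) θ - N.τ e) -
      max 0 (lam (N.tgt e) / lam (N.src e) - 1) * (l (N.src e) θ - l₀ (N.src e))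
  else 0

/-- Resetting arcs give equality. On arcs that start with zero gap, the term `max 0 (lam w / lam v -
1)` is fitted to the thin flow: saturation for `lam v < lam w`, no flow for `lam v > lam w`, and any
intermediate flow for equal slopes. -/
theorem IsThinFlow.le_arcPotential [Fintype E] [DecidableEq V] {N : Network V E}
    {l₀ lam : V → ℝ} {x : E → ℝ} (hx : N.IsThinFlow l₀ lam x) {l : V → ℝ → ℝ} {θ : ℝ} (e : E) :
    x e * ((l (N.tgt e) θ - l₀ (N.tgt e)) / lam (N.tgt e) -
      (l (N.src e) θ - l₀ (N.src e)) / lam (N.src e)) ≤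
      N.ν e * N.arcPotential l₀ lam l e θ := by
  have hν := N.ν_pos e
  have hv := hx.pos (N.src e)
  have hw := hx.pos (N.tgt e)
  unfold arcPotential
  split_ifs with h1 h2
  · rw [hx.of_isResetting e h1]
    refine le_of_eq ?_
    field_simp
  · have htie : l₀ (N.tgt e) = l₀ (N.src e) + N.τ e := by
      unfold IsActive at h2; unfold IsResetting at h1; linarith
    have hg : l (N.tgt e) θ - l (N.src e) θ - N.τ e =
      (l (N.tgt e) θ - l₀ (N.tgt e)) - (l (N.src e) θ - l₀ (N.src e)) := by
      rw [htie]; ring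
    rw [hg]
    generalize l (N.tgt e) θ - l₀ (N.tgt e) = y
    generalize l (N.src e) θ - l₀ (N.src e) = z
    rcases lt_trichotomy (lam (N.src e)) (lam (N.tgt e)) with hlt | heq | hgt
    · rw [hx.of_lt e h2 hlt, max_eq_right (a := 0) (b := lam (N.tgt e) / lam (N.src e) - 1)
        (sub_nonneg.2 ((one_le_div hv).2 hlt.le))]
      have : N.ν e * lam (N.tgt e) * (y / lam (N.tgt e) - z / lam (N.src e)) =
        N.ν e * (y - z - (lam (N.tgt e) / lam (N.src e) - 1) * z) := by
        field_simp
        ring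
      rw [this]
      gcongr
      exact le_max_right _ _
    · rw [heq, div_self hw.ne', sub_self, max_self, zero_mul, sub_zero, ← sub_div]
      have h0 := hx.nonneg e
      have h3 := hx.le_mul e
      have h4 : x e / lam (N.tgt e) ≤ N.ν e := (div_le_iff₀ hw).2 h3
      have h5 : 0 ≤ x e / lam (N.tgt e) := by positivity
      have h6 : x e * ((y - z) / lam (N.tgt e)) = x e / lam (N.tgt e) * (y - z) := by ring
      rw [h6]
      calc x e / lam (N.tgt e) * (y - z) ≤ x e / lam (N.tgt e) * max 0 (y - z) := by
            gcongr; exact le_max_right _ _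
        _ ≤ N.ν e * max 0 (y - z) := by gcongr
    · rw [hx.of_gt e h1 hgt, zero_mul, max_eq_left (a := 0)
        (b := lam (N.tgt e) / lam (N.src e) - 1) (by
          have := (div_le_one hv).2 hgt.le
          linarith), zero_mul, sub_zero]
      positivity
  · rw [hx.of_not_isActive e h2]
    simp

open Classical in
/-- The derivative of `arcPotential`. -/
noncomputable def arcPotentialSlope (N : Network V E) (l₀ lam : V → ℝ) (l : V → ℝ → ℝ) (θ : ℝ)
    (l' : V → ℝ) (e : E) : ℝ :=
  if N.IsResetting l₀ e then
    l' (N.tgt e) - lam (N.tgt e) / lam (N.src e) * l' (N.src e)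
  else if N.IsActive l₀ e then
    (if N.IsResetting (fun v => l v θ) e then l' (N.tgt e) - l' (N.src e) else 0) -
      max 0 (lam (N.tgt e) / lam (N.src e) - 1) * l' (N.src e)
  else 0

theorem IsSlope.hasDerivAt_arcPotential [Fintype E] [DecidableEq V] {N : Network V E}
    {l₀ lam : V → ℝ} {l : V → ℝ → ℝ} {θ : ℝ} {l' : V → ℝ} {x' : E → ℝ}
    (h : N.IsSlope l θ l' x') (e : E) :
    HasDerivAt (N.arcPotential l₀ lam l e) (N.arcPotentialSlope l₀ lam l θ l' e) θ := by
  unfold arcPotentialSlope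
  have hfun : N.arcPotential l₀ lam l e = fun θ => N.arcPotential l₀ lam l e θ := rfl
  rw [hfun]
  unfold arcPotential
  split_ifs with h1 h2 h3
  · exact ((h.hasDerivAt _).sub_const _).sub (((h.hasDerivAt _).sub_const _).const_mul _)
  · exact ((h.hasDerivAt_queue e).1 h3).sub (((h.hasDerivAt _).sub_const _).const_mul _)
  · exact ((h.hasDerivAt_queue e).2 h3).sub (((h.hasDerivAt _).sub_const _).const_mul _)
  · exact hasDerivAt_const _ _

/-- The entropy estimate. On a queue, `x' e = ν e * l' w` makes it an instance of the logarithmic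
inequality. Without a queue the left side is nonpositive; then equal slopes `l' w = l' v`, or `x' e
= 0` on an inactive arc, control the right side. -/
theorem IsThinFlow.arcPotentialSlope_le [Fintype E] [DecidableEq V] {N : Network V E}
    {l₀ lam : V → ℝ} {x : E → ℝ} (hx : N.IsThinFlow l₀ lam x)
    {l : V → ℝ → ℝ} {θ : ℝ} {l' : V → ℝ} {x' : E → ℝ} (h : N.IsSlope l θ l' x') (e : E)
    (hR : N.IsResetting l₀ e → N.IsResetting (fun v => l v θ) e)
    (hI : ¬ N.IsActive l₀ e → ¬ N.IsActive (fun v => l v θ) e) {ε : ℝ} (hε : 0 < ε) :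
    N.ν e * N.arcPotentialSlope l₀ lam l θ l' e ≤
      x' e * (Real.log (max (l' (N.tgt e) / lam (N.tgt e)) ε) -
        Real.log (max (l' (N.src e) / lam (N.src e)) ε)) + N.ν e * lam (N.tgt e) * ε := by
  have hν := N.ν_pos e
  have hv := hx.pos (N.src e)
  have hw := hx.pos (N.tgt e)
  have hv' := h.nonneg (N.src e)
  have hw' := h.nonneg (N.tgt e)
  have hx' := h.flow_nonneg e
  have hrv : 0 ≤ l' (N.src e) / lam (N.src e) := by positivity
  have hrw : 0 ≤ l' (N.tgt e) / lam (N.tgt e) := by positivity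
  have hmon : ∀ {a b : ℝ}, a ≤ b → Real.log (max a ε) ≤ Real.log (max b ε) := fun hab =>
    Real.log_le_log (lt_max_of_lt_right hε) (max_le_max_right _ hab)
  -- the main estimate if all queueing capacity is used
  have key : ∀ {b : ℝ}, l' (N.src e) / lam (N.src e) ≤ b → x' e = N.ν e * l' (N.tgt e) →
      N.ν e * (l' (N.tgt e) - lam (N.tgt e) * b) ≤
      x' e * (Real.log (max (l' (N.tgt e) / lam (N.tgt e)) ε) -
        Real.log (max (l' (N.src e) / lam (N.src e)) ε)) + N.ν e * lam (N.tgt e) * ε := by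
    intro b hb hxe
    have h1 := sub_sub_le_mul_log_max hrw (hrv.trans hb) hε
    have h2 := mul_le_mul_of_nonneg_left h1 (mul_pos hν hw).le
    have h3 : N.ν e * lam (N.tgt e) * (l' (N.tgt e) / lam (N.tgt e) *
        (Real.log (max (l' (N.tgt e) / lam (N.tgt e)) ε) - Real.log (max b ε))) =
        x' e * (Real.log (max (l' (N.tgt e) / lam (N.tgt e)) ε) - Real.log (max b ε)) := by
      rw [hxe]; field_simp
    have h4 : N.ν e * lam (N.tgt e) * (l' (N.tgt e) / lam (N.tgt e) - b - ε) =
        N.ν e * (l' (N.tgt e) - lam (N.tgt e) * b) - N.ν e * lam (N.tgt e) * ε := by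
      field_simp
    rw [h3, h4] at h2
    have h5 := mul_le_mul_of_nonneg_left (sub_le_sub_left (hmon hb)
      (Real.log (max (l' (N.tgt e) / lam (N.tgt e)) ε))) hx'
    linarith
  have hεt : 0 ≤ N.ν e * lam (N.tgt e) * ε := by positivity
  unfold arcPotentialSlope
  split_ifs with h1 h2 h3
  · have := key le_rfl (h.of_isResetting e (hR h1))
    convert! this using 2
    ring
  · rcases le_total (lam (N.src e)) (lam (N.tgt e)) with hle | hle
    · have := key le_rfl (h.of_isResetting e h3)
      rw [max_eq_right (sub_nonneg.2 ((one_le_div hv).2 hle))]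
      convert! this using 2
      ring
    -- For `lam w ≤ lam v` the potential has no correction term, and `l' w - l' v` is `lam w * (r w
    -- - b)` with `b = l' v / lam w`, which exceeds `r v` in the favourable direction.
    · have hb : l' (N.src e) / lam (N.src e) ≤ l' (N.src e) / lam (N.tgt e) :=
        div_le_div_of_nonneg_left hv' hw hle
      have := key hb (h.of_isResetting e h3)
      rw [mul_div_cancel₀ _ hw.ne'] at this
      rw [max_eq_left (sub_nonpos.2 ((div_le_one hv).2 hle)), zero_mul, sub_zero]
      exact this
  · rw [zero_sub]
    have hneg : N.ν e * -(max 0 (lam (N.tgt e) / lam (N.src e) - 1) * l' (N.src e)) ≤ 0 := by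
      have : 0 ≤ N.ν e * (max 0 (lam (N.tgt e) / lam (N.src e) - 1) * l' (N.src e)) := by
        positivity
      linarith
    by_cases h4 : N.IsActive (fun v => l v θ) e
    · have htie := h.of_tie e h4 h3
      rcases le_total (lam (N.src e)) (lam (N.tgt e)) with hle | hle
      · rw [max_eq_right (sub_nonneg.2 ((one_le_div hv).2 hle))]
        have hr : l' (N.tgt e) / lam (N.tgt e) ≤ l' (N.src e) / lam (N.src e) := by
          rw [htie]; exact div_le_div_of_nonneg_left hv' hv hle
        have h5 := sub_sub_le_mul_log_max hrw hrv hε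
        have h6 := mul_le_mul_of_nonneg_left h5 (mul_pos hν hw).le
        have h7 := mul_le_mul_of_nonpos_right (h.flow_le e) (sub_nonpos.2 (hmon hr))
        have h8 : N.ν e * lam (N.tgt e) * (l' (N.tgt e) / lam (N.tgt e) *
            (Real.log (max (l' (N.tgt e) / lam (N.tgt e)) ε) -
              Real.log (max (l' (N.src e) / lam (N.src e)) ε))) =
            N.ν e * l' (N.tgt e) * (Real.log (max (l' (N.tgt e) / lam (N.tgt e)) ε) -
              Real.log (max (l' (N.src e) / lam (N.src e)) ε)) := by
          field_simp
        have h9 : N.ν e * lam (N.tgt e) * (l' (N.tgt e) / lam (N.tgt e) -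
            l' (N.src e) / lam (N.src e) - ε) = N.ν e * -((lam (N.tgt e) / lam (N.src e) - 1) *
            l' (N.src e)) - N.ν e * lam (N.tgt e) * ε := by
          rw [htie]
          field_simp
          ring
        rw [h8, h9] at h6
        linarith
      · have hr : l' (N.src e) / lam (N.src e) ≤ l' (N.tgt e) / lam (N.tgt e) := by
          rw [htie]; exact div_le_div_of_nonneg_left hv' hw hle
        have := mul_nonneg hx' (sub_nonneg.2 (hmon hr))
        linarith
    · rw [h.of_not_isActive e h4, zero_mul]
      linarith
  · rw [h.of_not_isActive e (hI h2), mul_zero, zero_mul, zero_add]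
    exact hεt

/-- The fundamental theorem of calculus for absolutely continuous functions; slopes are only known
almost everywhere. -/
theorem _root_.AbsolutelyContinuousOnInterval.le_of_ae_hasDerivAt_nonpos {f : ℝ → ℝ} {a b : ℝ}
    (hab : a ≤ b) (hf : AbsolutelyContinuousOnInterval f a b)
    (h : ∀ᵐ x ∂(volume : Measure ℝ), x ∈ Ioo a b → ∃ d ≤ 0, HasDerivAt f d x) : f b ≤ f a := by
  rw [← sub_nonpos, ← hf.integral_deriv_eq_sub]
  have : 0 ≤ ∫ x in a..b, -deriv f x := by
    refine intervalIntegral.integral_nonneg_of_ae_restrict hab ?_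
    have hb : ∀ᵐ x ∂(volume : Measure ℝ), x ≠ b ∧ x ≠ a :=
      (Measure.ae_ne volume b).and (Measure.ae_ne volume a)
    rw [EventuallyLE, ae_restrict_iff' measurableSet_Icc]
    filter_upwards [h, hb] with x hx hxb hmem
    obtain ⟨d, hd, hfd⟩ := hx ⟨lt_of_le_of_ne' hmem.1 hxb.2, lt_of_le_of_ne hmem.2 hxb.1⟩
    rw [hfd.deriv]
    simpa using hd
  rw [intervalIntegral.integral_neg] at this
  linarith

theorem _root_.AbsolutelyContinuousOnInterval.const (c a b : ℝ) :
    AbsolutelyContinuousOnInterval (fun _ : ℝ => c) a b :=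
  (LipschitzWith.const c).lipschitzOnWith.absolutelyContinuousOnInterval

theorem _root_.AbsolutelyContinuousOnInterval.finset_sum {ι : Type*} {f : ι → ℝ → ℝ} {a b : ℝ}
    (s : Finset ι) (h : ∀ i ∈ s, AbsolutelyContinuousOnInterval (f i) a b) :
    AbsolutelyContinuousOnInterval (fun x => ∑ i ∈ s, f i x) a b := by
  classical
  induction s using Finset.induction_on with
  | empty => simpa using AbsolutelyContinuousOnInterval.const 0 a b
  | insert i s hi ih =>
    simp only [Finset.sum_insert hi]
    exact (h i (Finset.mem_insert_self _ _)).fun_add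
      (ih fun j hj => h j (Finset.mem_insert_of_mem hj))

theorem uIcc_subset_Ici {a b : ℝ} (ha : 0 ≤ a) (hab : a ≤ b) : uIcc a b ⊆ Ici 0 := by
  rw [uIcc_of_le hab]
  exact fun x hx => ha.trans hx.1

theorem IsTrajectory.absolutelyContinuous [Fintype E] [DecidableEq V] {N : Network V E}
    {l : V → ℝ → ℝ} {X : E → ℝ → ℝ} (h : N.IsTrajectory l X) (v : V) {a b : ℝ} (ha : 0 ≤ a)
    (hab : a ≤ b) : AbsolutelyContinuousOnInterval (l v) a b := by
  obtain ⟨K, hK⟩ := h.lipschitz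
  exact ((hK v).mono (uIcc_subset_Ici ha hab)).absolutelyContinuousOnInterval

theorem IsTrajectory.absolutelyContinuous_arcPotential [Fintype E] [DecidableEq V]
    {N : Network V E} {l : V → ℝ → ℝ} {X : E → ℝ → ℝ} (h : N.IsTrajectory l X) (l₀ lam : V → ℝ)
    (e : E) {a b : ℝ} (ha : 0 ≤ a) (hab : a ≤ b) :
    AbsolutelyContinuousOnInterval (N.arcPotential l₀ lam l e) a b := by
  have hl := fun v => h.absolutelyContinuous v ha hab
  have hc := fun c => AbsolutelyContinuousOnInterval.const c a b
  have hfun : N.arcPotential l₀ lam l e = fun θ => N.arcPotential l₀ lam l e θ := rfl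
  rw [hfun]
  unfold arcPotential
  split_ifs
  · exact ((hl _).fun_sub (hc _)).fun_sub (((hl _).fun_sub (hc _)).const_mul _)
  · refine AbsolutelyContinuousOnInterval.fun_sub ?_ (((hl _).fun_sub (hc _)).const_mul _)
    obtain ⟨K, hK⟩ := h.lipschitz
    have hgap := ((hK (N.tgt e)).sub (hK (N.src e))).sub
      (LipschitzWith.const (N.τ e)).lipschitzOnWith
    have := (LipschitzWith.id.const_max (0 : ℝ)).comp_lipschitzOnWith hgap
    exact (this.mono (uIcc_subset_Ici ha hab)).absolutelyContinuousOnInterval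
  · exact hc 0

/-- As long as no queue vanishes and no inactive arc becomes active, all arc potentials attain
their lower bounds. -/
theorem IsTrajectory.arcPotential_eq [Fintype V] [Fintype E] [DecidableEq V] {N : Network V E}
    {l : V → ℝ → ℝ} {X : E → ℝ → ℝ} (h : N.IsTrajectory l X) {l₀ lam : V → ℝ} {x : E → ℝ}
    (hx : N.IsThinFlow l₀ lam x) {a b : ℝ} (ha : 0 ≤ a) (hab : a ≤ b) (h₀ : ∀ v, l v a = l₀ v)
    (hR : ∀ e, N.IsResetting l₀ e → ∀ θ ∈ Icc a b, N.IsResetting (fun v => l v θ) e)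
    (hI : ∀ e, ¬ N.IsActive l₀ e → ∀ θ ∈ Icc a b, ¬ N.IsActive (fun v => l v θ) e) (e : E) :
    x e * ((l (N.tgt e) b - l₀ (N.tgt e)) / lam (N.tgt e) -
      (l (N.src e) b - l₀ (N.src e)) / lam (N.src e)) =
      N.ν e * N.arcPotential l₀ lam l e b := by
  let Γ : ℝ → ℝ := fun θ => ∑ e, N.ν e * N.arcPotential l₀ lam l e θ -
    N.u₀ * ((1 / lam N.t) * (l N.t θ - l₀ N.t) - (l N.s θ - l₀ N.s))
  have hΓa : Γ a = 0 := by
    have : ∀ e, N.arcPotential l₀ lam l e a = 0 := by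
      intro e
      unfold arcPotential
      split_ifs with h1 h2
      · simp [h₀]
      · unfold IsResetting at h1
        rw [max_eq_left (by rw [h₀, h₀]; linarith)]
        simp [h₀]
      · rfl
    simp [Γ, this, h₀]
  have hAC : AbsolutelyContinuousOnInterval Γ a b := by
    have hl := fun v => h.absolutelyContinuous v ha hab
    have hc := fun c => AbsolutelyContinuousOnInterval.const c a b
    exact (AbsolutelyContinuousOnInterval.finset_sum _ fun e _ =>
      (h.absolutelyContinuous_arcPotential l₀ lam e ha hab).const_mul _).fun_sub
      (((((hl _).fun_sub (hc _)).const_mul _).fun_sub ((hl _).fun_sub (hc _))).const_mul _)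
  have hΓb : Γ b ≤ 0 := by
    rw [← hΓa]
    refine hAC.le_of_ae_hasDerivAt_nonpos hab ?_
    filter_upwards [h.ae_exists_isSlope] with θ hθ hmem
    obtain ⟨l', x', hs⟩ := hθ (ha.trans_lt hmem.1)
    have hmem' : θ ∈ Icc a b := Ioo_subset_Icc_self hmem
    refine ⟨_, ?_, (HasDerivAt.fun_sum fun e _ => (hs.hasDerivAt_arcPotential e).const_mul _).sub
      (((((hs.hasDerivAt _).sub_const _).const_mul _).sub
        ((hs.hasDerivAt _).sub_const _)).const_mul _)⟩
    let S : ℝ := ∑ e, N.ν e * lam (N.tgt e)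
    refine le_of_forall_pos_le_add fun δ hδ => ?_
    have hS : 0 ≤ S := Finset.sum_nonneg fun e _ => (mul_pos (N.ν_pos e) (hx.pos _)).le
    have hu := N.u₀_pos
    -- The cutoff costs `S * ε` over the arcs and `u₀ * ε` in the bound of the logarithm at the
    -- sink. With `ε ≤ 1` the term at the source is `log 1 = 0`.
    obtain ⟨ε, hε, hε1, hεδ⟩ : ∃ ε : ℝ, 0 < ε ∧ ε ≤ 1 ∧ (S + N.u₀) * ε ≤ δ := by
      refine ⟨min 1 (δ / (S + N.u₀)), lt_min one_pos (by positivity), min_le_left _ _, ?_⟩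
      calc (S + N.u₀) * min 1 (δ / (S + N.u₀)) ≤ (S + N.u₀) * (δ / (S + N.u₀)) := by
            gcongr; exact min_le_right _ _
        _ = δ := by field_simp
    have hsum : ∑ e, N.ν e * N.arcPotentialSlope l₀ lam l θ l' e ≤ _ :=
      Finset.sum_le_sum fun e _ => hx.arcPotentialSlope_le hs e
        (fun he => hR e he θ hmem') (fun he => hI e he θ hmem') hε
    rw [Finset.sum_add_distrib,
      hs.balanced.sum_mul_sub (fun v => Real.log (max (l' v / lam v) ε)), ← Finset.sum_mul] at hsum
    rw [hs.source, hx.source, div_one, max_eq_left hε1, Real.log_one, sub_zero] at hsum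
    have hlt := hx.pos N.t
    have hlog : Real.log (max (l' N.t / lam N.t) ε) ≤ l' N.t / lam N.t + ε - 1 := by
      refine (Real.log_le_sub_one_of_pos (lt_max_of_lt_right hε)).trans ?_
      have : 0 ≤ l' N.t / lam N.t := div_nonneg (hs.nonneg _) hlt.le
      have := max_le (show l' N.t / lam N.t ≤ l' N.t / lam N.t + ε by linarith)
        (show ε ≤ l' N.t / lam N.t + ε by linarith)
      linarith
    have h1 := mul_le_mul_of_nonneg_left hlog hu.le
    rw [hs.source, one_div, inv_mul_eq_div]
    change _ ≤ _ + S * ε at hsum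
    linarith
  have hle : ∀ e ∈ Finset.univ, x e * ((l (N.tgt e) b - l₀ (N.tgt e)) / lam (N.tgt e) -
      (l (N.src e) b - l₀ (N.src e)) / lam (N.src e)) ≤
      N.ν e * N.arcPotential l₀ lam l e b := fun e _ => hx.le_arcPotential e
  -- The arcwise bounds sum to `Γ ≥ 0`. Together with `Γ b ≤ 0` the sums agree, so each summand
  -- does.
  refine (Finset.sum_eq_sum_iff_of_le hle).1 (le_antisymm (Finset.sum_le_sum hle) ?_) e
    (Finset.mem_univ _)
  rw [hx.balanced.sum_mul_sub (fun v => (l v b - l₀ v) / lam v)]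
  rw [hx.source, div_one]
  simp only [Γ, one_div, inv_mul_eq_div] at hΓb
  linarith

/-! ### Comparison with the thin flow and linear growth -/

/-- The thin flow for the labelling at the beginning respects the later queues. -/
theorem IsTrajectory.thinFlow_compat [Fintype V] [Fintype E] [DecidableEq V] {N : Network V E}
    {l : V → ℝ → ℝ} {X : E → ℝ → ℝ} (h : N.IsTrajectory l X) {l₀ lam : V → ℝ} {x : E → ℝ}
    (hx : N.IsThinFlow l₀ lam x) {a b : ℝ} (ha : 0 ≤ a) (hab : a ≤ b) (h₀ : ∀ v, l v a = l₀ v)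
    (hR : ∀ e, N.IsResetting l₀ e → ∀ θ ∈ Icc a b, N.IsResetting (fun v => l v θ) e)
    (hI : ∀ e, ¬ N.IsActive l₀ e → ∀ θ ∈ Icc a b, ¬ N.IsActive (fun v => l v θ) e) (e : E) :
    (N.IsResetting (fun v => l v b) e → x e = N.ν e * lam (N.tgt e)) ∧
      (¬ N.IsActive (fun v => l v b) e → x e = 0) := by
  have hν := N.ν_pos e
  have hv := hx.pos (N.src e)
  have hw := hx.pos (N.tgt e)
  have hb : b ∈ Icc a b := ⟨hab, le_rfl⟩
  by_cases h1 : N.IsResetting l₀ e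
  · exact ⟨fun _ => hx.of_isResetting e h1,
      fun h2 => absurd (hR e h1 b hb).isActive h2⟩
  by_cases h2 : N.IsActive l₀ e
  swap
  · exact ⟨fun h3 => absurd h3.isActive (hI e h2 b hb), fun _ => hx.of_not_isActive e h2⟩
  have heq := h.arcPotential_eq hx ha hab h₀ hR hI e
  have htie : l₀ (N.tgt e) = l₀ (N.src e) + N.τ e := by
    unfold IsActive at h2; unfold IsResetting at h1; linarith
  have hg : l (N.tgt e) b - l (N.src e) b - N.τ e =
    (l (N.tgt e) b - l₀ (N.tgt e)) - (l (N.src e) b - l₀ (N.src e)) := by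
    rw [htie]; ring
  unfold arcPotential at heq
  rw [if_neg h1, if_pos h2, hg] at heq
  have hres : N.IsResetting (fun v => l v b) e ↔
      l (N.src e) b - l₀ (N.src e) < l (N.tgt e) b - l₀ (N.tgt e) := by
    unfold IsResetting; rw [htie]; constructor <;> intro <;> linarith
  have hina : ¬ N.IsActive (fun v => l v b) e ↔
      l (N.tgt e) b - l₀ (N.tgt e) < l (N.src e) b - l₀ (N.src e) := by
    unfold IsActive; rw [htie, not_le]; constructor <;> intro <;> linarith
  rw [hres, hina]
  revert heq
  generalize l (N.tgt e) b - l₀ (N.tgt e) = y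
  generalize l (N.src e) b - l₀ (N.src e) = z
  intro heq
  -- For unequal slopes, tightness rules out the gap sign that would conflict with the known value
  -- of `x e`; for equal slopes, it determines `x e` whenever the gap is nonzero.
  rcases lt_trichotomy (lam (N.src e)) (lam (N.tgt e)) with hlt | hee | hgt
  · have hxe := hx.of_lt e h2 hlt
    refine ⟨fun _ => hxe, fun hyz => ?_⟩
    rw [hxe, max_eq_left (by linarith), max_eq_right (a := 0)
      (b := lam (N.tgt e) / lam (N.src e) - 1) (sub_nonneg.2 ((one_le_div hv).2 hlt.le))] at heq
    have : N.ν e * lam (N.tgt e) * (y / lam (N.tgt e) - z / lam (N.src e)) =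
        N.ν e * (y - z - (lam (N.tgt e) / lam (N.src e) - 1) * z) := by
      field_simp
      ring
    rw [this] at heq
    have := mul_left_cancel₀ hν.ne' heq
    linarith
  · rw [hee, div_self hw.ne', sub_self, max_self, zero_mul, sub_zero, ← sub_div] at heq
    refine ⟨fun hyz => ?_, fun hyz => ?_⟩
    · rw [max_eq_right (by linarith), mul_div_assoc', div_eq_iff hw.ne'] at heq
      have hpos : y - z ≠ 0 := by linarith
      refine mul_right_cancel₀ hpos ?_
      linarith
    · rw [max_eq_left (by linarith), mul_zero, mul_div_assoc', div_eq_zero_iff,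
        mul_eq_zero] at heq
      rcases heq with (heq | heq) | heq
      · exact heq
      · linarith
      · linarith
  · have hxe := hx.of_gt e h1 hgt
    refine ⟨fun hyz => ?_, fun _ => hxe⟩
    rw [hxe, zero_mul, max_eq_right (by linarith), max_eq_left (a := 0)
        (b := lam (N.tgt e) / lam (N.src e) - 1) (by
          have := (div_le_one hv).2 hgt.le
          linarith), zero_mul, sub_zero] at heq
    have : 0 < N.ν e * (y - z) := mul_pos hν (by linarith)
    linarith

/-- Slopes of a trajectory dominate those of a thin flow compatible with the queues, and queues
are not entered from nodes of equal slopes. -/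
theorem IsSlope.compare [Fintype V] [Fintype E] [DecidableEq V] {N : Network V E}
    {l : V → ℝ → ℝ} {X : E → ℝ → ℝ} (h : N.IsTrajectory l X) {l₀ lam : V → ℝ} {x : E → ℝ}
    (hx : N.IsThinFlow l₀ lam x) {θ : ℝ} (hθ : 0 ≤ θ) {l' : V → ℝ} {x' : E → ℝ}
    (hs : N.IsSlope l θ l' x')
    (hR : ∀ e, N.IsResetting l₀ e → N.IsResetting (fun v => l v θ) e)
    (hI : ∀ e, ¬ N.IsActive l₀ e → ¬ N.IsActive (fun v => l v θ) e)
    (hc : ∀ e, (N.IsResetting (fun v => l v θ) e → x e = N.ν e * lam (N.tgt e)) ∧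
      (¬ N.IsActive (fun v => l v θ) e → x e = 0)) :
    (∀ v, lam v ≤ l' v) ∧ ∀ e, N.IsResetting (fun v => l v θ) e →
      l' (N.src e) ≤ lam (N.src e) → l' (N.tgt e) ≤ lam (N.tgt e) := by
  classical
  have hreach := N.activeReach_source (fun w hw => h.entering w hw θ hθ)
  -- trichotomy of the arcs
  have hcase : ∀ e, (x' e = N.ν e * l' (N.tgt e) ∧ x e = N.ν e * lam (N.tgt e)) ∨
      (¬ N.IsActive (fun v => l v θ) e ∧ x' e = 0 ∧ x e = 0) ∨
      (l' (N.tgt e) = l' (N.src e) ∧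
        (lam (N.src e) < lam (N.tgt e) → x e = N.ν e * lam (N.tgt e)) ∧
        (lam (N.tgt e) < lam (N.src e) → x e = 0)) := by
    intro e
    by_cases h1 : N.IsResetting (fun v => l v θ) e
    · exact Or.inl ⟨hs.of_isResetting e h1, (hc e).1 h1⟩
    by_cases h2 : N.IsActive (fun v => l v θ) e
    · exact Or.inr (Or.inr ⟨hs.of_tie e h2 h1, hx.of_lt e (not_imp_not.1 (hI e) h2),
        hx.of_gt e (fun h3 => h1 (hR e h3))⟩)
    · exact Or.inr (Or.inl ⟨h2, hs.of_not_isActive e h2, (hc e).2 h2⟩)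
  constructor
  · by_contra! hcon
    obtain ⟨w, hw⟩ := hcon
    -- Both flows have the same net flow into `U`. Yet `x'` is at most `x` on entering arcs and at
    -- least `x` on leaving ones, strictly smaller on an active entering arc. On a zero-gap arc
    -- crossing the cut, equal `l'` at both ends forces the order of `lam`, and thereby `x e`.
    let U : Set V := {v | l' v < lam v}
    have hsU : N.s ∉ U := by simp [U, hs.source, hx.source]
    obtain ⟨e₀, he₀, hsrc, htgt⟩ := exists_enter_of_activeReach (hreach w) U hsU hw
    have hsum := (hs.balanced.sum_cut U hsU).trans (hx.balanced.sum_cut U hsU).symm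
    refine absurd hsum (ne_of_lt (Finset.sum_lt_sum (fun e _ => ?_)
      ⟨e₀, Finset.mem_univ _, ?_⟩))
    · have hν := N.ν_pos e
      by_cases h1 : N.tgt e ∈ U <;> by_cases h2 : N.src e ∈ U <;>
        simp only [h1, h2, if_true, if_false, sub_self, mul_zero, le_refl, sub_zero, zero_sub,
          mul_one, mul_neg, neg_le_neg_iff]
      · have h1 : l' (N.tgt e) < lam (N.tgt e) := h1
        have h2 : lam (N.src e) ≤ l' (N.src e) := not_lt.1 h2
        rcases hcase e with ⟨g1, g2⟩ | ⟨-, g1, g2⟩ | ⟨g1, g2, g3⟩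
        · rw [g1, g2]; gcongr
        · rw [g1, g2]
        · rw [g2 (by linarith)]
          exact (hs.flow_le e).trans (mul_le_mul_of_nonneg_left h1.le hν.le)
      · have h1 : lam (N.tgt e) ≤ l' (N.tgt e) := not_lt.1 h1
        have h2 : l' (N.src e) < lam (N.src e) := h2
        rcases hcase e with ⟨g1, g2⟩ | ⟨-, g1, g2⟩ | ⟨g1, g2, g3⟩
        · rw [g1, g2]; gcongr
        · rw [g1, g2]
        · rw [g3 (by linarith)]
          exact hs.flow_nonneg e
    · have hν := N.ν_pos e₀
      simp only [hsrc, htgt, if_true, if_false, sub_zero, mul_one]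
      have h1 : l' (N.tgt e₀) < lam (N.tgt e₀) := htgt
      have h2 : lam (N.src e₀) ≤ l' (N.src e₀) := not_lt.1 hsrc
      rcases hcase e₀ with ⟨g1, g2⟩ | ⟨g0, g1, g2⟩ | ⟨g1, g2, g3⟩
      · rw [g1, g2]; gcongr
      · exact absurd he₀ g0
      · rw [g2 (by linarith)]
        exact (hs.flow_le e₀).trans_lt (mul_lt_mul_of_pos_left h1 hν)
  · intro e₀ he₀ hsrc₀
    by_contra! htgt₀
    -- The mirrored cut; strictness now comes from the queue `e₀`, where both flows are saturated.
    let U : Set V := {v | lam v < l' v}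
    have hsU : N.s ∉ U := by simp [U, hs.source, hx.source]
    have htgt : N.tgt e₀ ∈ U := htgt₀
    have hsrc : N.src e₀ ∉ U := not_lt.2 hsrc₀
    have hsum := (hx.balanced.sum_cut U hsU).trans (hs.balanced.sum_cut U hsU).symm
    refine absurd hsum (ne_of_lt (Finset.sum_lt_sum (fun e _ => ?_)
      ⟨e₀, Finset.mem_univ _, ?_⟩))
    · have hν := N.ν_pos e
      by_cases h1 : N.tgt e ∈ U <;> by_cases h2 : N.src e ∈ U <;>
        simp only [h1, h2, if_true, if_false, sub_self, mul_zero, le_refl, sub_zero, zero_sub,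
          mul_one, mul_neg, neg_le_neg_iff]
      · have h1 : lam (N.tgt e) < l' (N.tgt e) := h1
        have h2 : l' (N.src e) ≤ lam (N.src e) := not_lt.1 h2
        rcases hcase e with ⟨g1, g2⟩ | ⟨-, g1, g2⟩ | ⟨g1, g2, g3⟩
        · rw [g1, g2]; gcongr
        · rw [g1, g2]
        · rw [g3 (by linarith)]
          exact hs.flow_nonneg e
      · have h1 : l' (N.tgt e) ≤ lam (N.tgt e) := not_lt.1 h1
        have h2 : lam (N.src e) < l' (N.src e) := h2
        rcases hcase e with ⟨g1, g2⟩ | ⟨-, g1, g2⟩ | ⟨g1, g2, g3⟩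
        · rw [g1, g2]; gcongr
        · rw [g1, g2]
        · rw [g2 (by linarith)]
          exact (hs.flow_le e).trans (mul_le_mul_of_nonneg_left h1 hν.le)
    · simp only [hsrc, htgt, if_true, if_false, sub_zero, mul_one]
      rw [hs.of_isResetting e₀ he₀, (hc e₀).1 he₀]
      exact mul_lt_mul_of_pos_left htgt₀ (N.ν_pos e₀)

/-- As long as no queue vanishes and no inactive arc becomes active, arrival times grow with the
slopes of the thin flow. -/
theorem IsTrajectory.eq_linear [Fintype V] [Fintype E] [DecidableEq V] {N : Network V E}
    {l : V → ℝ → ℝ} {X : E → ℝ → ℝ} (h : N.IsTrajectory l X) {l₀ lam : V → ℝ} {x : E → ℝ}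
    (hx : N.IsThinFlow l₀ lam x) {a b : ℝ} (ha : 0 ≤ a) (h₀ : ∀ v, l v a = l₀ v)
    (hR : ∀ e, N.IsResetting l₀ e → ∀ θ ∈ Icc a b, N.IsResetting (fun v => l v θ) e)
    (hI : ∀ e, ¬ N.IsActive l₀ e → ∀ θ ∈ Icc a b, ¬ N.IsActive (fun v => l v θ) e) (v : V) :
    ∀ θ ∈ Icc a b, l v θ = l₀ v + lam v * (θ - a) := by
  have hslope : ∀ᵐ θ ∂(volume : Measure ℝ), θ ∈ Ioo a b → ∃ l' x', N.IsSlope l θ l' x' ∧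
      (∀ v, lam v ≤ l' v) ∧ ∀ e, N.IsResetting (fun v => l v θ) e →
        l' (N.src e) ≤ lam (N.src e) → l' (N.tgt e) ≤ lam (N.tgt e) := by
    filter_upwards [h.ae_exists_isSlope] with θ hθ hmem
    obtain ⟨l', x', hs⟩ := hθ (ha.trans_lt hmem.1)
    have hmem' : θ ∈ Icc a b := Ioo_subset_Icc_self hmem
    refine ⟨l', x', hs, hs.compare h hx (ha.trans hmem.1.le) (fun e he => hR e he θ hmem')
      (fun e he => hI e he θ hmem') fun e => ?_⟩
    exact h.thinFlow_compat hx ha hmem.1.le h₀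
      (fun e he y hy => hR e he y ⟨hy.1, hy.2.trans hmem.2.le⟩)
      (fun e he y hy => hI e he y ⟨hy.1, hy.2.trans hmem.2.le⟩) e
  have hlow : ∀ v, ∀ θ ∈ Icc a b, l₀ v + lam v * (θ - a) ≤ l v θ := by
    intro v θ hθ
    have hAC : AbsolutelyContinuousOnInterval (fun y => lam v * (y - a) - l v y) a θ :=
      ((((LipschitzWith.id (α := ℝ)).lipschitzOnWith.absolutelyContinuousOnInterval).fun_sub
        (AbsolutelyContinuousOnInterval.const a a θ)).const_mul _).fun_sub
        (h.absolutelyContinuous v ha hθ.1)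
    have := hAC.le_of_ae_hasDerivAt_nonpos hθ.1 (by
      filter_upwards [hslope] with y hy hmem
      obtain ⟨l', x', hs, hle, -⟩ := hy ⟨hmem.1, hmem.2.trans_le hθ.2⟩
      refine ⟨_, ?_, (((hasDerivAt_id y).sub_const a).const_mul (lam v)).sub (hs.hasDerivAt v)⟩
      have := hle v
      linarith)
    rw [h₀, sub_self, mul_zero] at this
    linarith
  obtain ⟨r, -, hr⟩ := N.exists_rank l₀
  induction hn : r v using Nat.strong_induction_on generalizing v with
  | _ n ih =>
    intro θ hθ
    by_cases hv : v = N.s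
    · subst hv
      have h1 := h.source θ (ha.trans hθ.1)
      have h2 := h.source a ha
      rw [h₀] at h2
      rw [hx.source]
      linarith
    refine le_antisymm ?_ (hlow v θ hθ)
    obtain ⟨e, rfl, he, hee⟩ := hx.entering v hv
    have ihe := ih _ (hn ▸ hr e he) _ rfl
    by_contra! hlt
    have hcont : ContinuousOn (fun y => l (N.tgt e) y - (l₀ (N.tgt e) + lam (N.tgt e) * (y - a)))
        (Icc a θ) :=
      ((h.continuousOn _).mono fun y hy => ha.trans hy.1).sub (by fun_prop)
    have hcomp : IsCompact (Icc a θ ∩ (fun y => l (N.tgt e) y -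
        (l₀ (N.tgt e) + lam (N.tgt e) * (y - a))) ⁻¹' Iic 0) :=
      isCompact_Icc.of_isClosed_subset (hcont.preimage_isClosed_of_isClosed isClosed_Icc
        isClosed_Iic) inter_subset_left
    -- After the last time `c` at which `l w` is not above the line, the arc `e` carries a queue.
    -- Its tail has slope `lam v` by induction, so `l' w ≤ lam w` and the excess cannot grow from
    -- `c` to `θ`.
    obtain ⟨c, ⟨hc1, hc2⟩, hc3⟩ := hcomp.exists_isGreatest ⟨a, ⟨le_rfl, hθ.1⟩, by simp [h₀]⟩
    simp only [mem_preimage, mem_Iic] at hc2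
    have hac : 0 ≤ c := ha.trans hc1.1
    have hAC : AbsolutelyContinuousOnInterval
        (fun y => l (N.tgt e) y - lam (N.tgt e) * (y - a)) c θ :=
      (h.absolutelyContinuous _ hac hc1.2).fun_sub
      ((((LipschitzWith.id (α := ℝ)).lipschitzOnWith.absolutelyContinuousOnInterval).fun_sub
        (AbsolutelyContinuousOnInterval.const a c θ)).const_mul _)
    have := hAC.le_of_ae_hasDerivAt_nonpos hc1.2 (by
      filter_upwards [hslope] with y hy hmem
      have hyab : y ∈ Ioo a b := ⟨hc1.1.trans_lt hmem.1, hmem.2.trans_le hθ.2⟩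
      have hyab' : y ∈ Icc a b := Ioo_subset_Icc_self hyab
      obtain ⟨l', x', hs, hle, hres⟩ := hy hyab
      refine ⟨_, ?_, (hs.hasDerivAt _).sub
        (((hasDerivAt_id y).sub_const a).const_mul (lam (N.tgt e)))⟩
      have hpos : l₀ (N.tgt e) + lam (N.tgt e) * (y - a) < l (N.tgt e) y := by
        by_contra! hcon
        refine absurd (hc3 (a := y) ⟨⟨hyab.1.le, hmem.2.le⟩, ?_⟩) (not_le.2 hmem.1)
        simp only [mem_preimage, mem_Iic]
        linarith
      have hreset : N.IsResetting (fun v => l v y) e := by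
        by_cases h1 : N.IsResetting l₀ e
        · exact hR e h1 y hyab'
        · have h2 := hee.resolve_left h1
          have h3 := ihe y hyab'
          have h4 := mul_le_mul_of_nonneg_right h2 (sub_nonneg.2 hyab.1.le)
          unfold IsActive at he
          unfold IsResetting
          linarith
      have hsrc : l' (N.src e) = lam (N.src e) := by
        have hd : HasDerivAt (fun y => l₀ (N.src e) + lam (N.src e) * (y - a))
            (lam (N.src e)) y := by
          simpa using (((hasDerivAt_id y).sub_const a).const_mul (lam (N.src e))).const_add
            (l₀ (N.src e))
        refine (hs.hasDerivAt _).unique (hd.congr_of_eventuallyEq ?_)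
        filter_upwards [Icc_mem_nhds hyab.1 hyab.2] with z hz using ihe z hz
      have := hres e hreset hsrc.le
      linarith)
    linarith

/-! ### Feasibility and continuation -/

/-- Along the thin flow, queues stay on active paths to the sink. -/
theorem IsThinFlow.activeReach_sink [Fintype V] [Fintype E] [DecidableEq V] {N : Network V E}
    {l₀ lam : V → ℝ} {x : E → ℝ} (hx : N.IsThinFlow l₀ lam x) {l : V → ℝ} {σ : ℝ} (hσ : 0 ≤ σ)
    (hl : ∀ v, l v = l₀ v + lam v * σ) (hreach : ∀ v, N.ActiveReach l N.s v)
    (hR : ∀ e, N.IsResetting l₀ e → N.IsResetting l e)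
    (hI : ∀ e, ¬ N.IsActive l₀ e → ¬ N.IsActive l e) {e : E} (he : N.IsResetting l e) :
    N.ActiveReach l (N.tgt e) N.t := by
  classical
  have hact : ∀ e, 0 < x e → N.IsActive l e := by
    intro e hxe
    by_cases h1 : N.IsResetting l₀ e
    · exact (hR e h1).isActive
    have h2 : N.IsActive l₀ e := by
      by_contra h2
      exact hxe.ne' (hx.of_not_isActive e h2)
    have h3 : lam (N.src e) ≤ lam (N.tgt e) := by
      by_contra! h3
      exact hxe.ne' (hx.of_gt e h1 h3)
    have := mul_le_mul_of_nonneg_right h3 hσ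
    unfold IsActive at h2 ⊢
    rw [hl, hl]
    linarith
  have hxe : 0 < x e := by
    have : x e = N.ν e * lam (N.tgt e) := by
      by_cases h1 : N.IsResetting l₀ e
      · exact hx.of_isResetting e h1
      have h2 : N.IsActive l₀ e := by
        by_contra h2
        exact hI e h2 he.isActive
      refine hx.of_lt e h2 ?_
      unfold IsResetting at h1 he
      rw [hl, hl] at he
      by_contra! h3
      have := mul_le_mul_of_nonneg_right h3 hσ
      linarith
    rw [this]
    exact mul_pos (N.ν_pos e) (hx.pos _)
  -- All flow of `x` uses active arcs, hence none leaves `U`. Without the sink in `U` the net inflow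
  -- would be zero, but `e` brings in a positive amount.
  let U : Set V := {v | N.ActiveReach l (N.tgt e) v}
  by_contra htU
  have htU : N.t ∉ U := htU
  have hsU : N.s ∉ U := by
    intro hs
    refine N.not_transGen_active_self l N.s ?_
    exact Relation.TransGen.tail' (hreach (N.src e)) ⟨e, rfl, rfl, he.isActive⟩ |>.trans_left hs
  have hcut := hx.balanced.sum_cut U hsU
  rw [if_neg htU] at hcut
  refine absurd hcut (ne_of_gt (Finset.sum_pos' (fun e' _ => ?_) ⟨e, Finset.mem_univ _, ?_⟩))
  · have h0 := hx.nonneg e'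
    by_cases h1 : N.tgt e' ∈ U
    · by_cases h2 : N.src e' ∈ U <;> simp [h1, h2, h0]
    · by_cases h2 : N.src e' ∈ U
      · have : x e' = 0 := by
          by_contra hne
          exact h1 (Relation.ReflTransGen.tail h2 ⟨e', rfl, rfl, hact e' (h0.lt_of_ne' hne)⟩)
        simp [this]
      · simp [h1, h2]
  · have h1 : N.tgt e ∈ U := Relation.ReflTransGen.refl
    have h2 : N.src e ∉ U := by
      intro h2
      exact N.not_transGen_active_self l _ (Relation.TransGen.tail' h2 ⟨e, rfl, rfl, he.isActive⟩)
    simp [h1, h2, hxe]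

/-- The statuses of the arcs persist for a while. -/
theorem IsTrajectory.exists_persist [Fintype V] [Fintype E] [DecidableEq V] {N : Network V E}
    {l : V → ℝ → ℝ} {X : E → ℝ → ℝ} (h : N.IsTrajectory l X) {a : ℝ} (ha : 0 ≤ a) :
    ∃ b > a, ∀ e,
      (N.IsResetting (fun v => l v a) e → ∀ θ ∈ Icc a b, N.IsResetting (fun v => l v θ) e) ∧
      (¬ N.IsActive (fun v => l v a) e → ∀ θ ∈ Icc a b, ¬ N.IsActive (fun v => l v θ) e) := by
  have hc : ∀ v, Tendsto (l v) (𝓝[≥] a) (𝓝 (l v a)) := fun v =>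
    ((h.continuousOn v).mono (Ici_subset_Ici.2 ha)) a self_mem_Ici
  have hev : ∀ᶠ θ in 𝓝[≥] a, ∀ e,
      (N.IsResetting (fun v => l v a) e → N.IsResetting (fun v => l v θ) e) ∧
      (¬ N.IsActive (fun v => l v a) e → ¬ N.IsActive (fun v => l v θ) e) := by
    refine eventually_all.2 fun e => Eventually.and ?_ ?_
    · by_cases he : N.IsResetting (fun v => l v a) e
      · filter_upwards [((hc (N.src e)).add_const (N.τ e)).eventually_lt (hc (N.tgt e)) he]
          with θ hθ _ using hθ
      · exact Eventually.of_forall fun θ h => absurd h he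
    · by_cases he : N.IsActive (fun v => l v a) e
      · exact Eventually.of_forall fun θ h => absurd he h
      · simp only [IsActive, not_le] at he ⊢
        filter_upwards [(hc (N.tgt e)).eventually_lt ((hc (N.src e)).add_const (N.τ e)) he]
          with θ hθ _ using hθ
  obtain ⟨b, hb, hsub⟩ := (mem_nhdsGE_iff_exists_Icc_subset (a := a)).1 hev
  exact ⟨b, hb, fun e => ⟨fun he θ hθ => (hsub hθ e).1 he, fun he θ hθ => (hsub hθ e).2 he⟩⟩

/-- Two trajectories that agree at `a` with a feasible labelling agree for a while, and the
labellings stay feasible. -/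
theorem IsTrajectory.exists_eq_right [Fintype V] [Fintype E] [DecidableEq V] {N : Network V E}
    {l₁ l₂ : V → ℝ → ℝ} {X₁ X₂ : E → ℝ → ℝ} (h₁ : N.IsTrajectory l₁ X₁)
    (h₂ : N.IsTrajectory l₂ X₂) {a : ℝ} (ha : 0 ≤ a) (heq : ∀ v, l₁ v a = l₂ v a)
    (hfeas : (fun v => l₁ v a) ∈ N.feasibleLabellings) :
    ∃ b > a, ∀ θ ∈ Icc a b, (∀ v, l₁ v θ = l₂ v θ) ∧
      (fun v => l₁ v θ) ∈ N.feasibleLabellings := by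
  obtain ⟨lam, x, hx⟩ := N.exists_isThinFlow hfeas
  obtain ⟨b₁, hb₁, p₁⟩ := h₁.exists_persist ha
  obtain ⟨b₂, hb₂, p₂⟩ := h₂.exists_persist ha
  have hl : (fun v => l₂ v a) = fun v => l₁ v a := funext fun v => (heq v).symm
  rw [hl] at p₂
  have e₁ := h₁.eq_linear hx ha (fun v => rfl) (fun e => (p₁ e).1) (fun e => (p₁ e).2)
  have e₂ := h₂.eq_linear hx ha (fun v => (heq v).symm) (fun e => (p₂ e).1) (fun e => (p₂ e).2)
  refine ⟨min b₁ b₂, lt_min hb₁ hb₂, fun θ hθ => ?_⟩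
  have m₁ : θ ∈ Icc a b₁ := ⟨hθ.1, hθ.2.trans (min_le_left _ _)⟩
  have m₂ : θ ∈ Icc a b₂ := ⟨hθ.1, hθ.2.trans (min_le_right _ _)⟩
  have hreach := N.activeReach_source (fun w hw => h₁.entering w hw θ (ha.trans hθ.1))
  refine ⟨fun v => by rw [e₁ v θ m₁, e₂ v θ m₂], hreach, fun e he => ?_⟩
  exact hx.activeReach_sink (sub_nonneg.2 hθ.1) (fun v => e₁ v θ m₁) hreach
    (fun e he => (p₁ e).1 he θ m₁) (fun e he => (p₁ e).2 he θ m₁) he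

theorem ActiveReach.mono {N : Network V E} {l l' : V → ℝ}
    (h : ∀ e, N.IsActive l e → N.IsActive l' e) {v w : V} (hvw : N.ActiveReach l v w) :
    N.ActiveReach l' v w := by
  refine Relation.ReflTransGen.mono ?_ v w hvw
  rintro _ _ ⟨e, h1, h2, h3⟩
  exact ⟨e, h1, h2, h e h3⟩

/-- Feasibility of the labellings is preserved under limits from the left. -/
theorem IsTrajectory.feasible_of_left [Fintype V] [Fintype E] [DecidableEq V] {N : Network V E}
    {l : V → ℝ → ℝ} {X : E → ℝ → ℝ} (h : N.IsTrajectory l X) {a : ℝ} (ha : 0 < a)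
    (hfeas : ∀ θ ∈ Ico 0 a, (fun v => l v θ) ∈ N.feasibleLabellings) :
    (fun v => l v a) ∈ N.feasibleLabellings := by
  have hc : ∀ v, Tendsto (l v) (𝓝[<] a) (𝓝 (l v a)) := fun v =>
    ((h.continuousOn v).continuousAt (Ici_mem_nhds ha)).tendsto.mono_left nhdsWithin_le_nhds
  refine ⟨N.activeReach_source (fun w hw => h.entering w hw a ha.le), fun e he => ?_⟩
  -- Being resetting and being inactive are open conditions: just before `a` the arc `e` is already
  -- resetting, and every arc active there is still active at `a`. So an earlier path to the sink
  -- survives.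
  have hev : ∀ᶠ θ in 𝓝[<] a, N.IsResetting (fun v => l v θ) e ∧
      ∀ e, N.IsActive (fun v => l v θ) e → N.IsActive (fun v => l v a) e := by
    refine Eventually.and ?_ (eventually_all.2 fun e => ?_)
    · exact ((hc (N.src e)).add_const (N.τ e)).eventually_lt (hc (N.tgt e)) he
    · by_cases he : N.IsActive (fun v => l v a) e
      · exact Eventually.of_forall fun θ _ => he
      · simp only [IsActive, not_le] at he ⊢
        filter_upwards [(hc (N.tgt e)).eventually_lt ((hc (N.src e)).add_const (N.τ e)) he]
          with θ hθ h using absurd hθ (not_lt.2 h)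
  obtain ⟨θ, ⟨h1, h2⟩, h3⟩ := (hev.and (Ico_mem_nhdsLT ha)).exists
  exact ActiveReach.mono h2 ((hfeas θ h3).2 e h1)

/-- The arrival times of a trajectory are determined by the initial labelling. -/
theorem IsTrajectory.unique [Fintype V] [Fintype E] [DecidableEq V] {N : Network V E}
    {l₁ l₂ : V → ℝ → ℝ} {X₁ X₂ : E → ℝ → ℝ} (h₁ : N.IsTrajectory l₁ X₁)
    (h₂ : N.IsTrajectory l₂ X₂) (heq : ∀ v, l₁ v 0 = l₂ v 0)
    (hfeas : (fun v => l₁ v 0) ∈ N.feasibleLabellings) {θ : ℝ} (hθ : 0 ≤ θ) (v : V) :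
    l₁ v θ = l₂ v θ := by
  let P : ℝ → Prop := fun θ => (∀ v, l₁ v θ = l₂ v θ) ∧
    (fun v => l₁ v θ) ∈ N.feasibleLabellings
  by_contra hcon
  let B : Set ℝ := {y | 0 ≤ y ∧ ¬ P y}
  have hB : B.Nonempty := ⟨θ, hθ, fun h => hcon (h.1 v)⟩
  have hbdd : BddBelow B := ⟨0, fun y hy => hy.1⟩
  have ha : 0 ≤ sInf B := le_csInf hB fun y hy => hy.1
  have hbefore : ∀ y, 0 ≤ y → y < sInf B → P y := by
    intro y hy hlt
    by_contra hP
    exact absurd (csInf_le hbdd ⟨hy, hP⟩) (not_le.2 hlt)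
  have hPa : P (sInf B) := by
    rcases ha.eq_or_lt with h0 | h0
    · rw [← h0]; exact ⟨heq, hfeas⟩
    · refine ⟨fun v => ?_, h₁.feasible_of_left h0 fun y hy => (hbefore y hy.1 hy.2).2⟩
      have c₁ := ((h₁.continuousOn v).continuousAt (Ici_mem_nhds h0)).tendsto.mono_left
        (nhdsWithin_le_nhds (s := Iio (sInf B)))
      have c₂ := ((h₂.continuousOn v).continuousAt (Ici_mem_nhds h0)).tendsto.mono_left
        (nhdsWithin_le_nhds (s := Iio (sInf B)))
      refine tendsto_nhds_unique_of_eventuallyEq c₁ c₂ ?_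
      filter_upwards [Ico_mem_nhdsLT h0] with y hy using (hbefore y hy.1 hy.2).1 v
  obtain ⟨b, hb, hgood⟩ := h₁.exists_eq_right h₂ ha hPa.1 hPa.2
  obtain ⟨y, hy, hyb⟩ := exists_lt_of_csInf_lt hB hb
  exact hy.2 (hgood y ⟨csInf_le hbdd hy, hyb.le⟩)

/-! ### Flows over time: queues and exit times -/

theorem integral_le_of_ae_Ioo {f g : ℝ → ℝ} {a b : ℝ} (hab : a ≤ b)
    (hf : IntervalIntegrable f volume a b) (hg : IntervalIntegrable g volume a b)
    (h : ∀ᵐ x ∂(volume : Measure ℝ), x ∈ Ioo a b → f x ≤ g x) :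
    ∫ x in a..b, f x ≤ ∫ x in a..b, g x := by
  refine intervalIntegral.integral_mono_ae_restrict hab hf hg ?_
  rw [EventuallyLE, ae_restrict_iff' measurableSet_Icc]
  filter_upwards [h, Measure.ae_ne volume a, Measure.ae_ne volume b] with x hx ha hb hmem
  exact hx ⟨lt_of_le_of_ne' hmem.1 ha, lt_of_le_of_ne hmem.2 hb⟩

/-- The amount of flow that has entered `e` since the beginning. -/
noncomputable def cumInflow (N : Network V E) (l₀ : V → ℝ) (f : FlowRates E) (e : E) (ξ : ℝ) : ℝ :=
  ∫ ζ in (l₀ (N.src e))..ξ, f.inflow e ζ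

/-- The amount of flow that has left `e` since the beginning. -/
noncomputable def cumOutflow (N : Network V E) (l₀ : V → ℝ) (f : FlowRates E) (e : E)
    (ξ : ℝ) : ℝ :=
  ∫ ζ in (l₀ (N.src e) + N.τ e)..ξ, f.outflow e ζ

section flow

variable [Fintype E] [DecidableEq V] {N : Network V E} {l₀ : V → ℝ} {f : FlowRates E}

theorem IsFlowOverTime.inflow_intervalIntegrable (h : N.IsFlowOverTime l₀ f) (e : E) (a b : ℝ) :
    IntervalIntegrable (f.inflow e) volume a b :=
  ((h.inflow_integrable e).integrableOn_isCompact isCompact_uIcc).intervalIntegrable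

theorem IsFlowOverTime.outflow_intervalIntegrable (h : N.IsFlowOverTime l₀ f) (e : E) (a b : ℝ) :
    IntervalIntegrable (f.outflow e) volume a b :=
  ((h.outflow_integrable e).integrableOn_isCompact isCompact_uIcc).intervalIntegrable

theorem IsFlowOverTime.cumInflow_sub (h : N.IsFlowOverTime l₀ f) (e : E) (a b : ℝ) :
    N.cumInflow l₀ f e b - N.cumInflow l₀ f e a = ∫ ζ in a..b, f.inflow e ζ :=
  intervalIntegral.integral_interval_sub_left (h.inflow_intervalIntegrable e _ _)
    (h.inflow_intervalIntegrable e _ _)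

theorem IsFlowOverTime.cumOutflow_sub (h : N.IsFlowOverTime l₀ f) (e : E) (a b : ℝ) :
    N.cumOutflow l₀ f e b - N.cumOutflow l₀ f e a = ∫ ζ in a..b, f.outflow e ζ :=
  intervalIntegral.integral_interval_sub_left (h.outflow_intervalIntegrable e _ _)
    (h.outflow_intervalIntegrable e _ _)

theorem IsFlowOverTime.queue_eq (h : N.IsFlowOverTime l₀ f) (e : E) (ξ : ℝ) :
    N.queue l₀ f e ξ = N.ν e * max 0 (l₀ (N.tgt e) - l₀ (N.src e) - N.τ e) +
      N.cumInflow l₀ f e ξ - N.cumOutflow l₀ f e (ξ + N.τ e) := by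
  have hint : IntervalIntegrable (fun ζ => f.outflow e (ζ + N.τ e)) volume (l₀ (N.src e)) ξ := by
    simpa using (h.outflow_intervalIntegrable e (l₀ (N.src e) + N.τ e) (ξ + N.τ e)).comp_add_right
      (N.τ e)
  unfold queue cumInflow cumOutflow
  rw [intervalIntegral.integral_sub (h.inflow_intervalIntegrable e _ _) hint,
    intervalIntegral.integral_comp_add_right (fun ζ => f.outflow e ζ)]
  ring

theorem IsFlowOverTime.cumOutflow_sub_eq_comp (h : N.IsFlowOverTime l₀ f) (e : E) (a b : ℝ) :
    N.cumOutflow l₀ f e (b + N.τ e) - N.cumOutflow l₀ f e (a + N.τ e) =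
      ∫ ζ in a..b, f.outflow e (ζ + N.τ e) := by
  rw [h.cumOutflow_sub, intervalIntegral.integral_comp_add_right (fun ζ => f.outflow e ζ)]

theorem IsFlowOverTime.outflow_comp_intervalIntegrable (h : N.IsFlowOverTime l₀ f) (e : E)
    (a b : ℝ) : IntervalIntegrable (fun ζ => f.outflow e (ζ + N.τ e)) volume a b := by
  simpa using (h.outflow_intervalIntegrable e (a + N.τ e) (b + N.τ e)).comp_add_right (N.τ e)

theorem IsFlowOverTime.outflow_le (h : N.IsFlowOverTime l₀ f) (e : E) :
    ∀ᵐ ξ ∂(volume : Measure ℝ), f.outflow e ξ ≤ N.ν e := by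
  have hshift := (measurePreserving_sub_right (volume : Measure ℝ)
    (N.τ e)).quasiMeasurePreserving.ae (h.outflow_eq e)
  filter_upwards [hshift] with ξ hξ
  rcases lt_or_ge ξ (l₀ (N.src e) + N.τ e) with hlt | hge
  · rw [h.outflow_start e ξ hlt]
    exact (N.ν_pos e).le
  · have := hξ (by linarith)
    rw [sub_add_cancel] at this
    rw [this]
    split_ifs
    · exact le_rfl
    · exact min_le_right _ _

/-- Arcs discharge at rate at most `ν`, so conservation bounds what a node can send on. This makes
exit times Lipschitz. -/
theorem IsFlowOverTime.inflow_le (h : N.IsFlowOverTime l₀ f) (e : E) :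
    ∀ᵐ ξ ∂(volume : Measure ℝ), f.inflow e ξ ≤ N.u₀ + ∑ e, N.ν e := by
  have hu := N.u₀_pos
  have hcons : ∀ v, ∀ᵐ ξ ∂(volume : Measure ℝ), l₀ v ≤ ξ →
      ∑ e with N.src e = v, f.inflow e ξ ≤ N.u₀ + ∑ e with N.tgt e = v, f.outflow e ξ := by
    intro v
    by_cases hs : v = N.s
    · subst hs
      filter_upwards [h.source] with ξ hξ hle using (hξ hle).le
    by_cases ht : v = N.t
    · subst ht
      filter_upwards [h.sink] with ξ hξ hle
      have := hξ hle
      linarith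
    · filter_upwards [h.conservation v hs ht] with ξ hξ hle
      have := hξ hle
      linarith
  have hout := ae_all_iff.2 h.outflow_le
  filter_upwards [hcons (N.src e), hout] with ξ h1 h2
  rcases lt_or_ge ξ (l₀ (N.src e)) with hlt | hge
  · rw [h.inflow_start e ξ hlt]
    have : 0 ≤ ∑ e, N.ν e := Finset.sum_nonneg fun e _ => (N.ν_pos e).le
    linarith
  · have h3 : f.inflow e ξ ≤ ∑ e' with N.src e' = N.src e, f.inflow e' ξ :=
      Finset.single_le_sum (f := fun e' => f.inflow e' ξ) (fun e' _ => h.inflow_nonneg e' ξ)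
        (by simp)
    have h4 : ∑ e' with N.tgt e' = N.src e, f.outflow e' ξ ≤ ∑ e, N.ν e :=
      (Finset.sum_le_sum fun e _ => h2 e).trans (Finset.sum_le_sum_of_subset_of_nonneg
        (Finset.filter_subset _ _) fun e _ _ => (N.ν_pos e).le)
    have := h1 hge
    linarith

theorem IsFlowOverTime.cumInflow_mono (h : N.IsFlowOverTime l₀ f) (e : E) :
    Monotone (N.cumInflow l₀ f e) := by
  intro a b hab
  have := h.cumInflow_sub e a b
  have := intervalIntegral.integral_nonneg_of_forall (μ := volume) hab (h.inflow_nonneg e)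
  linarith

theorem IsFlowOverTime.cumOutflow_mono (h : N.IsFlowOverTime l₀ f) (e : E) :
    Monotone (N.cumOutflow l₀ f e) := by
  intro a b hab
  have := h.cumOutflow_sub e a b
  have := intervalIntegral.integral_nonneg_of_forall (μ := volume) hab (h.outflow_nonneg e)
  linarith

theorem IsFlowOverTime.cumInflow_sub_le (h : N.IsFlowOverTime l₀ f) (e : E) {a b : ℝ}
    (hab : a ≤ b) : N.cumInflow l₀ f e b - N.cumInflow l₀ f e a ≤
      (N.u₀ + ∑ e, N.ν e) * (b - a) := by
  rw [h.cumInflow_sub]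
  refine (intervalIntegral.integral_mono_ae hab (h.inflow_intervalIntegrable e _ _)
    intervalIntegrable_const (h.inflow_le e)).trans_eq ?_
  rw [intervalIntegral.integral_const, smul_eq_mul, mul_comm]

theorem IsFlowOverTime.cumOutflow_sub_le (h : N.IsFlowOverTime l₀ f) (e : E) {a b : ℝ}
    (hab : a ≤ b) : N.cumOutflow l₀ f e b - N.cumOutflow l₀ f e a ≤ N.ν e * (b - a) := by
  rw [h.cumOutflow_sub]
  refine (intervalIntegral.integral_mono_ae hab (h.outflow_intervalIntegrable e _ _)
    intervalIntegrable_const (h.outflow_le e)).trans_eq ?_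
  rw [intervalIntegral.integral_const, smul_eq_mul, mul_comm]

theorem IsFlowOverTime.cumInflow_eq_zero (h : N.IsFlowOverTime l₀ f) (e : E) {ξ : ℝ}
    (hξ : ξ ≤ l₀ (N.src e)) : N.cumInflow l₀ f e ξ = 0 := by
  unfold cumInflow
  rw [intervalIntegral.integral_symm, neg_eq_zero, ← intervalIntegral.integral_zero
    (a := ξ) (b := l₀ (N.src e)) (μ := volume)]
  refine intervalIntegral.integral_congr_uIoo fun x hx => ?_
  rw [uIoo_of_le hξ] at hx
  exact h.inflow_start e x hx.2

theorem IsFlowOverTime.cumOutflow_eq_zero (h : N.IsFlowOverTime l₀ f) (e : E) {ξ : ℝ}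
    (hξ : ξ ≤ l₀ (N.src e) + N.τ e) : N.cumOutflow l₀ f e ξ = 0 := by
  unfold cumOutflow
  rw [intervalIntegral.integral_symm, neg_eq_zero, ← intervalIntegral.integral_zero
    (a := ξ) (b := l₀ (N.src e) + N.τ e) (μ := volume)]
  refine intervalIntegral.integral_congr_uIoo fun x hx => ?_
  rw [uIoo_of_le hξ] at hx
  exact h.outflow_start e x hx.2

theorem IsFlowOverTime.cumOutflow_nonneg (h : N.IsFlowOverTime l₀ f) (e : E) (ξ : ℝ) :
    0 ≤ N.cumOutflow l₀ f e ξ := by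
  rcases le_total ξ (l₀ (N.src e) + N.τ e) with hξ | hξ
  · exact (h.cumOutflow_eq_zero e hξ).ge
  · rw [← h.cumOutflow_eq_zero e le_rfl]
    exact h.cumOutflow_mono e hξ

theorem IsFlowOverTime.queue_sub_le (h : N.IsFlowOverTime l₀ f) (e : E) {a b : ℝ} (hab : a ≤ b) :
    N.queue l₀ f e b - N.queue l₀ f e a ≤ (N.u₀ + ∑ e, N.ν e) * (b - a) := by
  have h1 := h.cumInflow_sub_le e hab
  have h2 := h.cumOutflow_mono e (add_le_add_left hab (N.τ e))
  rw [h.queue_eq, h.queue_eq]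
  linarith

theorem IsFlowOverTime.le_queue_sub (h : N.IsFlowOverTime l₀ f) (e : E) {a b : ℝ} (hab : a ≤ b) :
    -(N.ν e * (b - a)) ≤ N.queue l₀ f e b - N.queue l₀ f e a := by
  have h1 := h.cumInflow_mono e hab
  have h2 := h.cumOutflow_sub_le e (add_le_add_left hab (N.τ e))
  rw [h.queue_eq, h.queue_eq]
  rw [add_sub_add_right_eq_sub] at h2
  linarith

theorem IsFlowOverTime.continuous_queue (h : N.IsFlowOverTime l₀ f) (e : E) :
    Continuous (N.queue l₀ f e) := by
  have hfun : N.queue l₀ f e = fun ξ => N.queue l₀ f e ξ := rfl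
  rw [hfun]
  have h1 : Continuous (N.cumInflow l₀ f e) := intervalIntegral.continuous_primitive
    (fun a b => h.inflow_intervalIntegrable e a b) _
  have h2 : Continuous (N.cumOutflow l₀ f e) := intervalIntegral.continuous_primitive
    (fun a b => h.outflow_intervalIntegrable e a b) _
  simp only [h.queue_eq]
  fun_prop

theorem IsFlowOverTime.queue_start (h : N.IsFlowOverTime l₀ f) (e : E) {ξ : ℝ}
    (hξ : ξ ≤ l₀ (N.src e)) :
    N.queue l₀ f e ξ = N.ν e * max 0 (l₀ (N.tgt e) - l₀ (N.src e) - N.τ e) := by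
  rw [h.queue_eq, h.cumInflow_eq_zero e hξ, h.cumOutflow_eq_zero e (by linarith)]
  ring

theorem IsFlowOverTime.queue_nonneg (h : N.IsFlowOverTime l₀ f) (e : E) (ξ : ℝ) :
    0 ≤ N.queue l₀ f e ξ := by
  have hν := N.ν_pos e
  rcases le_total ξ (l₀ (N.src e)) with hξ | hξ
  · rw [h.queue_start e hξ]
    positivity
  by_contra! hneg
  -- After the last time `c` with nonnegative queue, the outflow is at most the inflow, so the queue
  -- cannot have dropped below its value at `c`.
  obtain ⟨c, ⟨hc1, hc2⟩, hc3⟩ := (isCompact_Icc.inter_right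
    (isClosed_le continuous_const (h.continuous_queue e))).exists_isGreatest
    (s := Icc (l₀ (N.src e)) ξ ∩ {y | 0 ≤ N.queue l₀ f e y})
    ⟨l₀ (N.src e), ⟨le_rfl, hξ⟩, by
      rw [Set.mem_ofPred_eq, h.queue_start e le_rfl]; positivity⟩
  have hc2 : 0 ≤ N.queue l₀ f e c := hc2
  have hint : ∫ ζ in c..ξ, f.outflow e (ζ + N.τ e) ≤ ∫ ζ in c..ξ, f.inflow e ζ := by
    refine integral_le_of_ae_Ioo hc1.2 (h.outflow_comp_intervalIntegrable e _ _)
      (h.inflow_intervalIntegrable e _ _) ?_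
    filter_upwards [h.outflow_eq e] with ζ hζ hmem
    have hq : ¬ 0 < N.queue l₀ f e ζ := by
      intro hq
      exact absurd (hc3 ⟨⟨hc1.1.trans hmem.1.le, hmem.2.le⟩, hq.le⟩) (not_le.2 hmem.1)
    rw [hζ (hc1.1.trans hmem.1.le), if_neg hq]
    exact min_le_left _ _
  rw [← h.cumOutflow_sub_eq_comp, ← h.cumInflow_sub] at hint
  rw [h.queue_eq] at hneg hc2
  linarith

theorem IsFlowOverTime.cumOutflow_sub_eq_of_queue_pos (h : N.IsFlowOverTime l₀ f) (e : E)
    {a b : ℝ} (ha : l₀ (N.src e) ≤ a) (hab : a ≤ b)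
    (hq : ∀ ξ ∈ Ioo a b, 0 < N.queue l₀ f e ξ) :
    N.cumOutflow l₀ f e (b + N.τ e) - N.cumOutflow l₀ f e (a + N.τ e) = N.ν e * (b - a) := by
  rw [h.cumOutflow_sub_eq_comp]
  have hconst : ∫ _ in a..b, N.ν e = N.ν e * (b - a) := by
    rw [intervalIntegral.integral_const, smul_eq_mul, mul_comm]
  have hae : ∀ᵐ ζ ∂(volume : Measure ℝ), ζ ∈ Ioo a b → f.outflow e (ζ + N.τ e) = N.ν e := by
    filter_upwards [h.outflow_eq e] with ζ hζ hmem
    rw [hζ (ha.trans hmem.1.le), if_pos (hq ζ hmem)]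
  rw [← hconst]
  refine le_antisymm
    (integral_le_of_ae_Ioo hab (h.outflow_comp_intervalIntegrable e _ _)
      intervalIntegrable_const ?_)
    (integral_le_of_ae_Ioo hab intervalIntegrable_const
      (h.outflow_comp_intervalIntegrable e _ _) ?_)
  · filter_upwards [hae] with ζ hζ hmem using (hζ hmem).le
  · filter_upwards [hae] with ζ hζ hmem using (hζ hmem).ge

/-- First in, first out: the flow that entered `e` before time `ξ` has left it at the exit time. -/
theorem IsFlowOverTime.cumOutflow_exitTime (h : N.IsFlowOverTime l₀ f) (e : E) {ξ : ℝ}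
    (hξ : l₀ (N.src e) ≤ ξ) : N.cumOutflow l₀ f e (N.exitTime l₀ f e ξ) =
      N.ν e * max 0 (l₀ (N.tgt e) - l₀ (N.src e) - N.τ e) + N.cumInflow l₀ f e ξ := by
  have hν := N.ν_pos e
  have hq := h.queue_nonneg e ξ
  have hle : ξ ≤ ξ + N.queue l₀ f e ξ / N.ν e := le_add_of_nonneg_right (by positivity)
  -- The queue loses at most `ν` per unit of time, so it stays positive throughout the waiting time
  -- of `ξ`, during which the arc discharges at capacity.
  have := h.cumOutflow_sub_eq_of_queue_pos e hξ hle (fun ζ hζ => by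
    have h1 := h.le_queue_sub e hζ.1.le
    have h2 : (ζ - ξ) < N.queue l₀ f e ξ / N.ν e := by linarith [hζ.2]
    rw [lt_div_iff₀' hν] at h2
    linarith)
  rw [add_sub_cancel_left, mul_div_cancel₀ _ hν.ne', h.queue_eq] at this
  unfold exitTime
  rw [h.queue_eq]
  linarith

theorem IsFlowOverTime.exitTime_mono (h : N.IsFlowOverTime l₀ f) (e : E) :
    Monotone (N.exitTime l₀ f e) := by
  intro a b hab
  have hν := N.ν_pos e
  have h1 := h.le_queue_sub e hab
  have h2 : N.queue l₀ f e a / N.ν e - (b - a) ≤ N.queue l₀ f e b / N.ν e := by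
    rw [le_div_iff₀ hν, sub_mul, div_mul_cancel₀ _ hν.ne']
    linarith
  unfold exitTime
  linarith

theorem IsFlowOverTime.exitTime_sub_le (h : N.IsFlowOverTime l₀ f) (e : E) {a b : ℝ}
    (hab : a ≤ b) : N.exitTime l₀ f e b - N.exitTime l₀ f e a ≤
      (1 + (N.u₀ + ∑ e, N.ν e) / N.ν e) * (b - a) := by
  have hν := N.ν_pos e
  have h1 := h.queue_sub_le e hab
  have h2 : (N.queue l₀ f e b - N.queue l₀ f e a) / N.ν e ≤
      (N.u₀ + ∑ e, N.ν e) * (b - a) / N.ν e := by gcongr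
  rw [sub_div] at h2
  have h3 : (N.u₀ + ∑ e, N.ν e) * (b - a) / N.ν e =
    (N.u₀ + ∑ e, N.ν e) / N.ν e * (b - a) := by ring
  unfold exitTime
  linarith

theorem IsFlowOverTime.add_le_exitTime (h : N.IsFlowOverTime l₀ f) (e : E) (ξ : ℝ) :
    ξ + N.τ e ≤ N.exitTime l₀ f e ξ := by
  have := div_nonneg (h.queue_nonneg e ξ) (N.ν_pos e).le
  unfold exitTime
  linarith

end flow

/-! ### From Nash flows to trajectories -/

section nash

variable [Fintype E] [DecidableEq V] {N : Network V E} {l₀ : V → ℝ} {f : FlowRates E}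
  {l : V → ℝ → ℝ}

/-- At every time, every node but the source is reached along an active arc by which the earliest
arrival time is attained. -/
theorem IsNashFlow.exists_tight (h : N.IsNashFlow l₀ f l) {w : V} (hw : w ≠ N.s) {θ : ℝ}
    (hθ : 0 ≤ θ) : ∃ e, N.tgt e = w ∧ l w θ = N.exitTime l₀ f e (l (N.src e) θ) ∧
      N.IsActive (fun v => l v θ) e := by
  obtain ⟨e, rfl, he⟩ := (h.arrival.bellman w hw θ hθ).1
  exact ⟨e, rfl, he, (h.flow.add_le_exitTime e _).trans_eq he.symm⟩

theorem IsNashFlow.activeReach [Fintype V] (h : N.IsNashFlow l₀ f l) {θ : ℝ} (hθ : 0 ≤ θ) (v : V) :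
    N.ActiveReach (fun v => l v θ) N.s v :=
  N.activeReach_source (fun w hw => by
    obtain ⟨e, h1, -, h2⟩ := h.exists_tight hw hθ
    exact ⟨e, h1, h2⟩) v

theorem IsNashFlow.le_exitTime [Fintype V] (h : N.IsNashFlow l₀ f l) (e : E) {θ : ℝ} (hθ : 0 ≤ θ) :
    l (N.tgt e) θ ≤ N.exitTime l₀ f e (l (N.src e) θ) := by
  by_cases hw : N.tgt e = N.s
  -- The Bellman equation excludes the source; there the bound holds because active paths from the
  -- source never decrease labels.
  · rw [hw]
    have h1 := (h.activeReach hθ (N.src e)).le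
    have h2 := h.flow.add_le_exitTime e (l (N.src e) θ)
    have h3 := N.τ_nonneg e
    linarith
  · exact (h.arrival.bellman _ hw θ hθ).2 ⟨e, rfl, rfl⟩

/-- Induction along arcs tight at the later particle `b`: going through such an arc at `a` already
arrives no later than `b` does. -/
theorem IsNashFlow.monotoneOn [Fintype V] (h : N.IsNashFlow l₀ f l) (v : V) :
    MonotoneOn (l v) (Ici 0) := by
  intro a ha b hb hab
  obtain ⟨r, -, hr⟩ := N.exists_rank fun v => l v b
  induction hn : r v using Nat.strong_induction_on generalizing v with
  | _ n ih =>
    by_cases hv : v = N.s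
    · subst hv
      rw [h.arrival.source a ha, h.arrival.source b hb]
      linarith
    · obtain ⟨e, rfl, h1, h2⟩ := h.exists_tight hv hb
      rw [h1]
      exact (h.le_exitTime e ha).trans (h.flow.exitTime_mono e (ih _ (hn ▸ hr e h2) _ rfl))

/-- Here the arcs tight at the earlier particle are followed: each multiplies the delay by at most
`L`, and ranks are at most the number of nodes. -/
theorem IsNashFlow.lipschitz [Fintype V] (h : N.IsNashFlow l₀ f l) :
    ∃ K : ℝ≥0, ∀ v, LipschitzOnWith K (l v) (Ici 0) := by
  have hC : 0 ≤ N.u₀ + ∑ e, N.ν e := add_nonneg N.u₀_pos.le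
    (Finset.sum_nonneg fun e _ => (N.ν_pos e).le)
  have hterm : ∀ e ∈ Finset.univ, 0 ≤ (N.u₀ + ∑ e, N.ν e) / N.ν e := fun e _ =>
    div_nonneg hC (N.ν_pos e).le
  let L : ℝ := 1 + ∑ e, (N.u₀ + ∑ e, N.ν e) / N.ν e
  have hL1 : 1 ≤ L := le_add_of_nonneg_right (Finset.sum_nonneg hterm)
  have hL : ∀ e, 1 + (N.u₀ + ∑ e, N.ν e) / N.ν e ≤ L := fun e =>
    add_le_add_right (Finset.single_le_sum hterm (Finset.mem_univ e)) 1
  have key : ∀ a b, 0 ≤ a → a ≤ b → ∀ v,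
      l v b - l v a ≤ L ^ Fintype.card V * (b - a) := by
    intro a b ha hab v
    have hb := ha.trans hab
    obtain ⟨r, hrle, hr⟩ := N.exists_rank fun v => l v a
    have hrank : ∀ v, l v b - l v a ≤ L ^ r v * (b - a) := by
      intro v
      induction hn : r v using Nat.strong_induction_on generalizing v with
      | _ n ih =>
        by_cases hv : v = N.s
        · subst hv
          rw [h.arrival.source a ha, h.arrival.source b hb]
          have := le_mul_of_one_le_left (sub_nonneg.2 hab) (one_le_pow₀ hL1 (n := n))
          linarith
        · obtain ⟨e, rfl, h1, h2⟩ := h.exists_tight hv ha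
          have hlt := hr e h2
          have ih := ih _ (hn ▸ hlt) _ rfl
          have hmono := h.monotoneOn (N.src e) ha hb hab
          calc l (N.tgt e) b - l (N.tgt e) a
              ≤ N.exitTime l₀ f e (l (N.src e) b) - N.exitTime l₀ f e (l (N.src e) a) := by
                rw [h1]; exact sub_le_sub_right (h.le_exitTime e hb) _
            _ ≤ (1 + (N.u₀ + ∑ e, N.ν e) / N.ν e) * (l (N.src e) b - l (N.src e) a) :=
                h.flow.exitTime_sub_le e hmono
            _ ≤ L * (L ^ r (N.src e) * (b - a)) :=
                mul_le_mul (hL e) ih (sub_nonneg.2 hmono) (by linarith)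
            _ = L ^ (r (N.src e) + 1) * (b - a) := by ring
            _ ≤ L ^ n * (b - a) := by
                have : 0 ≤ b - a := sub_nonneg.2 hab
                gcongr
                omega
    refine (hrank v).trans ?_
    have : 0 ≤ b - a := sub_nonneg.2 hab
    gcongr
    exact hrle v
  have hLn : 0 ≤ L ^ Fintype.card V := by positivity
  refine ⟨(L ^ Fintype.card V).toNNReal, fun v => LipschitzOnWith.of_le_add_mul _ ?_⟩
  intro a ha b hb
  rw [Real.coe_toNNReal _ hLn]
  rcases le_total a b with hab | hab
  · have h1 := h.monotoneOn v ha hb hab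
    have h2 : 0 ≤ L ^ Fintype.card V * dist a b := by positivity
    linarith
  · have := key b a hb hab v
    rw [Real.dist_eq, abs_of_nonneg (sub_nonneg.2 hab)]
    linarith

/-- No flow enters `e` at times that are not attained by tight particles. -/
theorem IsNashFlow.cumInflow_eq_of_not_tight (h : N.IsNashFlow l₀ f l) (e : E) {a b : ℝ}
    (hab : a ≤ b) (hnt : ∀ ξ ∈ Ioo a b, ∀ θ, 0 ≤ θ → l (N.src e) θ = ξ →
      l (N.tgt e) θ ≠ N.exitTime l₀ f e ξ) :
    N.cumInflow l₀ f e b = N.cumInflow l₀ f e a := by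
  have hzero : ∫ ζ in a..b, f.inflow e ζ ≤ ∫ ζ in a..b, (0 : ℝ) := by
    refine integral_le_of_ae_Ioo hab (h.flow.inflow_intervalIntegrable e _ _)
      intervalIntegrable_const ?_
    filter_upwards [h.equilibrium e] with ξ hξ hmem
    by_contra! hpos
    obtain ⟨θ, h1, h2, h3⟩ := hξ hpos
    exact hnt ξ hmem θ h1 h2 h3
  rw [← h.flow.cumInflow_sub, intervalIntegral.integral_zero] at hzero
  have := h.flow.cumInflow_mono e hab
  linarith

/-- In a Nash flow, the flow that entered `e` up to the arrival of the particle `θ` at the tail has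
left `e` at the arrival of `θ` at the head. -/
theorem IsNashFlow.cumOutflow_eq [Fintype V] (h : N.IsNashFlow l₀ f l)
    (h_init : ∀ v, l v 0 = l₀ v) (e : E) {θ : ℝ} (hθ : 0 ≤ θ) :
    N.cumOutflow l₀ f e (l (N.tgt e) θ) =
      N.ν e * max 0 (l₀ (N.tgt e) - l₀ (N.src e) - N.τ e) +
        N.cumInflow l₀ f e (l (N.src e) θ) := by
  have hge : ∀ v, l₀ v ≤ l v θ := fun v => by
    rw [← h_init v]; exact h.monotoneOn v self_mem_Ici hθ hθ
  refine le_antisymm ?_ ?_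
  · rw [← h.flow.cumOutflow_exitTime e (hge _)]
    exact h.flow.cumOutflow_mono e (h.le_exitTime e hθ)
  -- A particle `η` tight at such a `ξ` reaches the head after `θ`, hence `η > θ`; but then it
  -- cannot reach the tail before `θ`.
  have hnt : ∀ c, (∀ ξ, c < ξ → ξ ≤ l (N.src e) θ → l (N.tgt e) θ < N.exitTime l₀ f e ξ) →
      ∀ ξ ∈ Ioo c (l (N.src e) θ), ∀ η, 0 ≤ η → l (N.src e) η = ξ →
      l (N.tgt e) η ≠ N.exitTime l₀ f e ξ := by
    intro c hc ξ hξ η hη h1 h2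
    have h3 := hc ξ hξ.1 hξ.2.le
    rw [← h2] at h3
    have h4 : θ < η := by
      by_contra! hle
      exact absurd (h.monotoneOn (N.tgt e) hη hθ hle) (not_le.2 h3)
    have h5 := h.monotoneOn (N.src e) hθ hη h4.le
    rw [h1] at h5
    exact absurd h5 (not_le.2 hξ.2)
  have hTcont : Continuous (N.exitTime l₀ f e) := by
    have hfun : N.exitTime l₀ f e = fun ξ => ξ + N.queue l₀ f e ξ / N.ν e + N.τ e := rfl
    rw [hfun]
    have := h.flow.continuous_queue e
    fun_prop
  by_cases hstart : N.exitTime l₀ f e (l₀ (N.src e)) ≤ l (N.tgt e) θ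
  -- Let `c` be the last entrance time whose exit is no later than `l w θ`. Nothing enters between
  -- `c` and `l v θ`, and what entered before has left.
  · obtain ⟨c, ⟨hc1, hc2⟩, hc3⟩ := (isCompact_Icc.inter_right
      (isClosed_le hTcont continuous_const)).exists_isGreatest
      (s := Icc (l₀ (N.src e)) (l (N.src e) θ) ∩ {y | N.exitTime l₀ f e y ≤ l (N.tgt e) θ})
      ⟨l₀ (N.src e), ⟨le_rfl, hge _⟩, hstart⟩
    rw [h.cumInflow_eq_of_not_tight e hc1.2 (hnt c fun ξ h1 h2 => by
      by_contra! hle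
      exact absurd (hc3 ⟨⟨hc1.1.trans h1.le, h2⟩, hle⟩) (not_le.2 h1)),
      ← h.flow.cumOutflow_exitTime e hc1.1]
    exact h.flow.cumOutflow_mono e hc2
  -- Even the first entrance exits too late, so nothing has entered. There is no initial queue
  -- either: with one, that exit would be at `l₀ w ≤ l w θ`.
  · rw [not_le] at hstart
    rw [h.cumInflow_eq_of_not_tight e (hge _) (hnt _ fun ξ h1 h2 =>
      hstart.trans_le (h.flow.exitTime_mono e h1.le)), h.flow.cumInflow_eq_zero e le_rfl, add_zero]
    have hT : N.exitTime l₀ f e (l₀ (N.src e)) = l₀ (N.src e) +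
        max 0 (l₀ (N.tgt e) - l₀ (N.src e) - N.τ e) + N.τ e := by
      unfold exitTime
      rw [h.flow.queue_start e le_rfl, mul_div_cancel_left₀ _ (N.ν_pos e).ne']
    have hw := hge (N.tgt e)
    rcases le_total (l₀ (N.tgt e) - l₀ (N.src e) - N.τ e) 0 with hle | hle
    · rw [max_eq_left hle, mul_zero]
      exact h.flow.cumOutflow_nonneg e _
    · rw [hT, max_eq_right hle] at hstart
      linarith

/-- The queue is the outflow between `l v θ + τ e` and `l w θ`. This is at most `ν` times the
duration, and the shortest path inequality gives the converse. -/
theorem IsNashFlow.queue_eq_max [Fintype V] (h : N.IsNashFlow l₀ f l)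
    (h_init : ∀ v, l v 0 = l₀ v) (e : E) {θ : ℝ} (hθ : 0 ≤ θ) : N.queue l₀ f e (l (N.src e) θ) =
      N.ν e * max 0 (l (N.tgt e) θ - l (N.src e) θ - N.τ e) := by
  have hν := N.ν_pos e
  have hq : N.queue l₀ f e (l (N.src e) θ) = N.cumOutflow l₀ f e (l (N.tgt e) θ) -
      N.cumOutflow l₀ f e (l (N.src e) θ + N.τ e) := by
    rw [h.flow.queue_eq, h.cumOutflow_eq h_init e hθ]
  have hq0 := h.flow.queue_nonneg e (l (N.src e) θ)
  rcases le_total (l (N.tgt e) θ - l (N.src e) θ - N.τ e) 0 with hle | hle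
  · rw [max_eq_left hle, mul_zero]
    have := h.flow.cumOutflow_mono e (show l (N.tgt e) θ ≤ l (N.src e) θ + N.τ e by linarith)
    linarith
  · rw [max_eq_right hle]
    refine le_antisymm ?_ ?_
    · have := h.flow.cumOutflow_sub_le e
        (show l (N.src e) θ + N.τ e ≤ l (N.tgt e) θ by linarith)
      rw [hq]
      linarith
    · have h1 := h.le_exitTime e hθ
      unfold exitTime at h1
      have h2 : l (N.tgt e) θ - l (N.src e) θ - N.τ e ≤
        N.queue l₀ f e (l (N.src e) θ) / N.ν e := by linarith
      rwa [le_div_iff₀' hν] at h2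

/-- The earliest arrival times of a Nash flow over time, with the cumulative inflows of the arcs,
form a trajectory. -/
theorem IsNashFlow.isTrajectory [Fintype V] (h : N.IsNashFlow l₀ f l) (h_init : ∀ v, l v 0 = l₀ v) :
    N.IsTrajectory l fun e θ => N.cumInflow l₀ f e (l (N.src e) θ) := by
  have hge : ∀ v θ, 0 ≤ θ → l₀ v ≤ l v θ := fun v θ hθ => by
    rw [← h_init v]; exact h.monotoneOn v self_mem_Ici hθ hθ
  have hcont : ∀ v, ContinuousOn (l v) (Ici 0) := by
    obtain ⟨K, hK⟩ := h.lipschitz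
    exact fun v => (hK v).continuousOn
  have hX : ∀ e θ, 0 ≤ θ → N.cumInflow l₀ f e (l (N.src e) θ) =
      ∫ ζ in (l₀ (N.tgt e))..(l (N.tgt e) θ), f.outflow e ζ := by
    intro e θ hθ
    have h1 := h.cumOutflow_eq h_init e hθ
    -- The case `θ = 0` says that exactly the initial queue has left by `l₀ w`, so the two initial
    -- terms cancel.
    have h2 := h.cumOutflow_eq h_init e le_rfl
    rw [h_init, h_init, h.flow.cumInflow_eq_zero e le_rfl] at h2
    rw [← h.flow.cumOutflow_sub]
    linarith
  have hsub : ∀ e a b, 0 ≤ a → a ≤ b → N.cumInflow l₀ f e (l (N.src e) b) -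
      N.cumInflow l₀ f e (l (N.src e) a) = N.cumOutflow l₀ f e (l (N.tgt e) b) -
      N.cumOutflow l₀ f e (l (N.tgt e) a) := by
    intro e a b ha hab
    rw [h.cumOutflow_eq h_init e ha, h.cumOutflow_eq h_init e (ha.trans hab)]
    ring
  have himage : ∀ v a b, 0 ≤ a → a ≤ b → ∀ ξ ∈ Ioo (l v a) (l v b), ∃ θ ∈ Icc a b, l v θ = ξ := by
    intro v a b ha hab ξ hξ
    exact intermediate_value_Icc hab ((hcont v).mono fun y hy => ha.trans hy.1)
      (Ioo_subset_Icc_self hξ)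
  refine ⟨fun θ hθ => ?_, h.monotoneOn, h.lipschitz, fun e => ?_, fun e a b ha hab => ?_,
    fun θ hθ => ?_, fun e a b ha hab hres => ?_, fun e a b ha hab hina => ?_, fun w hw θ hθ => ?_⟩
  · rw [h_init, h.arrival.source θ hθ]
  · exact (h.flow.cumInflow_mono e).comp_monotoneOn (h.monotoneOn _)
  · rw [hsub e a b ha hab]
    exact h.flow.cumOutflow_sub_le e (h.monotoneOn _ ha (ha.trans hab) hab)
  · have hout : ∀ v, ∑ e with N.src e = v, N.cumInflow l₀ f e (l (N.src e) θ) =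
        ∫ ζ in (l₀ v)..(l v θ), ∑ e with N.src e = v, f.inflow e ζ := by
      intro v
      rw [intervalIntegral.integral_finsetSum fun e _ => h.flow.inflow_intervalIntegrable e _ _]
      refine Finset.sum_congr rfl fun e he => ?_
      rw [← (Finset.mem_filter.1 he).2]
      rfl
    have hin : ∀ v, ∑ e with N.tgt e = v, N.cumInflow l₀ f e (l (N.src e) θ) =
        ∫ ζ in (l₀ v)..(l v θ), ∑ e with N.tgt e = v, f.outflow e ζ := by
      intro v
      rw [intervalIntegral.integral_finsetSum fun e _ => h.flow.outflow_intervalIntegrable e _ _]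
      refine Finset.sum_congr rfl fun e he => ?_
      rw [← (Finset.mem_filter.1 he).2]
      exact hX e θ hθ
    -- At the sink only an inequality is given; its balance follows from those of the other nodes.
    refine N.isBalanced_of_ne N.t fun v hv => ?_
    rw [hout, hin, if_neg hv, sub_zero]
    by_cases hs : v = N.s
    · subst hs
      have hint : IntervalIntegrable (fun ζ => ∑ e with N.tgt e = N.s, f.outflow e ζ) volume
          (l₀ N.s) (l N.s θ) := by
        simpa [Finset.sum_fn] using IntervalIntegrable.sum _ fun e _ =>
          h.flow.outflow_intervalIntegrable e (l₀ N.s) (l N.s θ)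
      have hcongr : ∫ ζ in (l₀ N.s)..(l N.s θ), ∑ e with N.src e = N.s, f.inflow e ζ =
          ∫ ζ in (l₀ N.s)..(l N.s θ), (N.u₀ + ∑ e with N.tgt e = N.s, f.outflow e ζ) := by
        refine intervalIntegral.integral_congr_ae ?_
        filter_upwards [h.flow.source] with ζ hζ hmem
        rw [uIoc_of_le (hge _ θ hθ)] at hmem
        exact hζ hmem.1.le
      rw [hcongr, intervalIntegral.integral_add intervalIntegrable_const hint,
        intervalIntegral.integral_const, h.arrival.source θ hθ, if_pos rfl, smul_eq_mul]
      ring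
    · rw [if_neg hs, sub_eq_zero]
      refine intervalIntegral.integral_congr_ae ?_
      filter_upwards [h.flow.conservation v hs hv] with ζ hζ hmem
      rw [uIoc_of_le (hge _ θ hθ)] at hmem
      exact hζ hmem.1.le
  · have hb := ha.trans hab
    have hmono := h.monotoneOn (N.src e) ha hb hab
    have hq := h.flow.cumOutflow_sub_eq_of_queue_pos e (hge _ a ha) hmono (fun ξ hξ => by
      obtain ⟨θ, hθ, rfl⟩ := himage _ a b ha hab ξ hξ
      rw [h.queue_eq_max h_init e (ha.trans hθ.1)]
      have := hres θ hθ
      unfold IsResetting at this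
      exact mul_pos (N.ν_pos e) (lt_max_of_lt_right (by linarith)))
    have hqa := h.queue_eq_max h_init e ha
    have hqb := h.queue_eq_max h_init e hb
    have ra := hres a ⟨le_rfl, hab⟩
    have rb := hres b ⟨hab, le_rfl⟩
    unfold IsResetting at ra rb
    rw [h.flow.queue_eq, max_eq_right (a := 0) (b := l (N.tgt e) a - l (N.src e) a - N.τ e)
      (by linarith)] at hqa
    rw [h.flow.queue_eq, max_eq_right (a := 0) (b := l (N.tgt e) b - l (N.src e) b - N.τ e)
      (by linarith)] at hqb
    linarith
  · refine h.cumInflow_eq_of_not_tight e (h.monotoneOn _ ha (ha.trans hab) hab) ?_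
    intro ξ hξ θ hθ h1 h2
    have hθmem : θ ∈ Icc a b := by
      constructor
      · by_contra! hlt
        have := h.monotoneOn (N.src e) hθ ha hlt.le
        rw [h1] at this
        exact absurd this (not_le.2 hξ.1)
      · by_contra! hlt
        have := h.monotoneOn (N.src e) (ha.trans hab) hθ hlt.le
        rw [h1] at this
        exact absurd this (not_le.2 hξ.2)
    refine hina θ hθmem ?_
    change l (N.src e) θ + N.τ e ≤ l (N.tgt e) θ
    rw [h2, h1]
    exact h.flow.add_le_exitTime e ξ
  · obtain ⟨e, h1, -, h2⟩ := h.exists_tight hw hθ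
    exact ⟨e, h1, h2⟩

end nash

end Network

/-- The earliest arrival time functions of a Nash flow over time are determined by the
initial labelling. -/
theorem mainTheorem1 {V E : Type*} [Fintype V] [DecidableEq V] [Fintype E]
    (N : Network V E) (l₀ : V → ℝ) (hl₀ : l₀ ∈ N.feasibleLabellings)
    (f₁ f₂ : FlowRates E) (l₁ l₂ : V → ℝ → ℝ)
    (h₁ : N.IsNashFlow l₀ f₁ l₁) (h₁_init : ∀ v, l₁ v 0 = l₀ v)
    (h₂ : N.IsNashFlow l₀ f₂ l₂) (h₂_init : ∀ v, l₂ v 0 = l₀ v) :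
    ∀ v θ, 0 ≤ θ → l₁ v θ = l₂ v θ := by
  intro v θ hθ
  have t₁ := h₁.isTrajectory h₁_init
  have t₂ := h₂.isTrajectory h₂_init
  refine t₁.unique t₂ (fun v => by rw [h₁_init, h₂_init]) ?_ hθ v
  rwa [show (fun v => l₁ v 0) = l₀ from funext h₁_init]
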